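/- **Definitions.** A coarse space is a set $X$ with a collection of controlled subsets of $X\times X$ that contains the diagonal and is closed under subsets, inverses, finite unions and compositions $E\circ F=\{(x,z):\exists y,\ (x,y)\in E,\ (y,z)\in F\}$. A controlled set $E$ is symmetric if $E^{-1}=E$. Put $E_x=\{y:(y,x)\in E\}$ and $E_U=\bigcup_{x\in U}E_x$. A set $U$ is bounded if $U\times U$ is controlled, and $E$-bounded if $U\times U\subseteq E$. $X$ has bounded geometry if there is a symmetric controlled $F$ such that for each controlled $E$ there is $N$ such that every $E_x$ is covered by at most $N$ $F$-bounded sets. $X$ and $X'$ are coarsely equivalent if there are maps $f:X\to X'$ and $g:X'\to X$ such that $f\times f$ and $g\times g$ map controlled sets to controlled sets and $\{(x,gf(x))\}$ and $\{(x',fg(x'))\}$ are controlled. Let $\mu$ be a measure on a $\sigma$-algebra on $X$ containing all singletons. A controlled set $E$ is measurable if $E_U$ is measurable for all measurable $U$. $\mu$ is uniformly bounded if for each controlled $E$ there is a finite $C$ with $\mu(U)\le C$ for all $E$-bounded measurable $U$. A controlled set $E$ is gordo if it is symmetric and measurable and $\inf_x\mu(E_x)>0$. $T\in B(L^2(X,\mu))$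 is supported on a measurable controlled set $E$ if $\langle\xi,T\eta\rangle=\langle\xi,T(\eta|_{E_U})\rangle$ for all measurable $U$, all $\xi$ supported on $U$ and all $\eta$. Let $\mathbb C_{cs}[X]$ be the unital $*$-algebra of all $T$ supported on some measurable controlled set. For $T\in\mathbb C_{cs}[X]$ let $\Phi(T)=T(\mathbb 1_X)$, the locally $L^2$ function with $\langle\xi,\Phi(T)\rangle=\langle T^*\xi,\mathbb 1_X\rangle$ for all $\xi\in L^2$ with bounded support. For $f\in L^\infty$ let $M_f$ be multiplication by $f$. $T$ is an operator in $(E,\epsilon)$-blocks if it is supported on $\bigsqcup_i A_i\times A_i$ for some pairwise disjoint measurable sets $A_i$ with $A_i\times A_i\subseteq E$ and $\mu(A_i)\ge\epsilon$. A representation is a unital $*$-homomorphism $\rho:\mathbb C_{cs}[X]\to B(\mathcal H)$ for some Hilbert space $\mathcal H$; $\mathcal H_c$ is the subspace of all $v$ with $\rho(T)v=\rho(M_{\Phi(T)})v$ for all $T$ with $\Phi(T)$ bounded. $(X,\mu)$ has *geometric property (T)* if there are a controlled set $E$ and $\epsilon,\gamma>0$ such that for every representation $(\rho,\mathcal H)$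 and every unit vector $v\in\mathcal H_c^\perp$ there is a nonzero operator $T$ in $(E,\epsilon)$-blocks with $\Phi(T)$ bounded and $\|(\rho(T)-\rho(M_{\Phi(T)}))v\|\ge\gamma\|T\|$, where $\|T\|$ is the operator norm on $L^2(X,\mu)$. **Theorem.** Let $X$ and $X'$ be coarsely equivalent coarse spaces of bounded geometry, each covered by countably many bounded sets, and let $\mu$ and $\mu'$ be uniformly bounded measures on $X$ and $X'$ (each on a $\sigma$-algebra containing the singletons) for which gordo sets exist. Then $(X,\mu)$ has geometric property (T) if and only if $(X',\mu')$ does. In particular, for any two such measures $\mu,\nu$ on $X$, possibly on different $\sigma$-algebras, $(X,\mu)$ has geometric property (T) if and only if $(X,\nu)$ does. -/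

import Mathlib

open MeasureTheory Set
open scoped ENNReal NNReal

universe u

/-- A coarse structure on a set `X`: a collection of controlled subsets of `X × X`. -/
class CoarseSpace (X : Type u) where
  IsControlled : Set (X × X) → Prop
  diagonal : IsControlled {p | p.1 = p.2}
  subset : ∀ {E F : Set (X × X)}, IsControlled E → F ⊆ E → IsControlled F
  inverse : ∀ {E : Set (X × X)}, IsControlled E → IsControlled {p | (p.2, p.1) ∈ E}
  union : ∀ {E F : Set (X × X)}, IsControlled E → IsControlled F → IsControlled (E ∪ F)
  comp : ∀ {E F : Set (X × X)}, IsControlled E → IsControlled F →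
    IsControlled {p | ∃ y, (p.1, y) ∈ E ∧ (y, p.2) ∈ F}

namespace Coarse


section Basic

variable {X : Type u}

/-- The composition `E ∘ F`. -/
def compRel (E F : Set (X × X)) : Set (X × X) := {p | ∃ y, (p.1, y) ∈ E ∧ (y, p.2) ∈ F}

/-- `E⁻¹ = E`. -/
def IsSymmRel (E : Set (X × X)) : Prop := ∀ x y, (x, y) ∈ E ↔ (y, x) ∈ E

/-- `E_x = {y | (y, x) ∈ E}`. -/
def nbhd (E : Set (X × X)) (x : X) : Set X := {y | (y, x) ∈ E}

/-- `E_U`, the union of the `E_x` over `x ∈ U`. -/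
def nbhdSet (E : Set (X × X)) (U : Set X) : Set X := ⋃ x ∈ U, nbhd E x

/-- `U` is `E`-bounded. -/
def IsRelBounded (E : Set (X × X)) (U : Set X) : Prop := U ×ˢ U ⊆ E

/-- A subset `U` of a coarse space is bounded if `U × U` is controlled. -/
def IsBoundedSet [CoarseSpace X] (U : Set X) : Prop := CoarseSpace.IsControlled (U ×ˢ U)

/-- A controlled set `F` is covering if it is symmetric and for every controlled `E` there is `N`
such that each `E_x` can be covered by at most `N` sets that are `F`-bounded. -/
def IsCovering [CoarseSpace X] (F : Set (X × X)) : Prop :=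
  CoarseSpace.IsControlled F ∧ IsSymmRel F ∧
    ∀ E : Set (X × X), CoarseSpace.IsControlled E →
      ∃ N : ℕ, ∀ x, ∃ U : Fin N → Set X, (∀ i, IsRelBounded F (U i)) ∧ nbhd E x ⊆ ⋃ i, U i

variable (X) in
/-- Bounded geometry: there is a controlled covering set. -/
def HasBoundedGeometry [CoarseSpace X] : Prop := ∃ F : Set (X × X), IsCovering F

variable (X) in
/-- `X` is covered by countably many bounded sets. -/
def IsCountablyBounded [CoarseSpace X] : Prop :=
  ∃ B : ℕ → Set X, (∀ n, IsBoundedSet (B n)) ∧ ⋃ n, B n = univ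

/-- Coarse equivalence of coarse spaces. -/
def CoarselyEquivalent (X Y : Type u) [CoarseSpace X] [CoarseSpace Y] : Prop :=
  ∃ (f : X → Y) (g : Y → X),
    (∀ E : Set (X × X), CoarseSpace.IsControlled E →
      CoarseSpace.IsControlled (Prod.map f f '' E)) ∧
    (∀ F : Set (Y × Y), CoarseSpace.IsControlled F →
      CoarseSpace.IsControlled (Prod.map g g '' F)) ∧
    CoarseSpace.IsControlled (range fun x => (x, g (f x))) ∧
    CoarseSpace.IsControlled (range fun y => (y, f (g y)))

/-- A relation is measurable if `E_U` is measurable for all measurable `U`. -/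
def IsMeasurableRel [MeasurableSpace X] (E : Set (X × X)) : Prop :=
  ∀ U : Set X, MeasurableSet U → MeasurableSet (nbhdSet E U)

/-- `μ` is uniformly bounded: for each controlled `E` the measures of the measurable `E`-bounded
sets are bounded by a finite constant. -/
def IsUniformlyBounded [CoarseSpace X] {_ : MeasurableSpace X} (μ : Measure X) : Prop :=
  ∀ E : Set (X × X), CoarseSpace.IsControlled E →
    ∃ C : ℝ≥0, ∀ U : Set X, MeasurableSet U → IsRelBounded E U → μ U ≤ C

/-- `E` is gordo for `μ`: it is controlled, symmetric and measurable, and the measures `μ (E_x)`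
are bounded away from zero. -/
def IsGordo [CoarseSpace X] {_ : MeasurableSpace X} (μ : Measure X) (E : Set (X × X)) : Prop :=
  CoarseSpace.IsControlled E ∧ IsSymmRel E ∧ IsMeasurableRel E ∧
    ∃ ε : ℝ≥0, 0 < ε ∧ ∀ x, (ε : ℝ≥0∞) ≤ μ (nbhd E x)

lemma mem_nbhdSet {E : Set (X × X)} {U : Set X} {y : X} :
    y ∈ nbhdSet E U ↔ ∃ x ∈ U, (y, x) ∈ E := by
  simp [nbhdSet, nbhd]

lemma nbhdSet_compRel (E F : Set (X × X)) (U : Set X) :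
    nbhdSet (compRel E F) U = nbhdSet E (nbhdSet F U) := by
  ext z
  simp only [mem_nbhdSet, compRel, mem_ofPred_eq]
  constructor
  · rintro ⟨x, hx, y, h1, h2⟩
    exact ⟨y, ⟨x, hx, h2⟩, h1⟩
  · rintro ⟨y, ⟨x, hx, h2⟩, h1⟩
    exact ⟨x, hx, y, h1, h2⟩

lemma nbhdSet_union (E F : Set (X × X)) (U : Set X) :
    nbhdSet (E ∪ F) U = nbhdSet E U ∪ nbhdSet F U := by
  ext z
  simp only [mem_nbhdSet, mem_union]
  constructor
  · rintro ⟨x, hx, h | h⟩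
    · exact Or.inl ⟨x, hx, h⟩
    · exact Or.inr ⟨x, hx, h⟩
  · rintro (⟨x, hx, h⟩ | ⟨x, hx, h⟩)
    · exact ⟨x, hx, Or.inl h⟩
    · exact ⟨x, hx, Or.inr h⟩

lemma nbhdSet_diagonal (U : Set X) : nbhdSet {p : X × X | p.1 = p.2} U = U := by
  ext z
  simp [mem_nbhdSet]

end Basic

noncomputable section Operators

variable {X : Type u} {mX : MeasurableSpace X} (μ : Measure X)

/-- The Hilbert space `L²(X, μ)` of complex-valued functions. -/
abbrev L2 : Type u := Lp ℂ 2 μ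

/-- `ξ` is supported on `U` (almost everywhere). -/
def SupportedIn {μ : Measure X} (ξ : L2 μ) (U : Set X) : Prop := ∀ᵐ x ∂μ, x ∉ U → ξ x = 0

/-- `T` is supported on the measurable relation `E`: for all measurable `U`, all `ξ` supported on
`U` and all `η`, one has `⟨ξ, T η⟩ = ⟨ξ, T (η|_{E_U})⟩`; here `η'` is the class of `η|_{E_U}`. -/
def IsSupportedOn {μ : Measure X} (T : L2 μ →L[ℂ] L2 μ) (E : Set (X × X)) : Prop :=
  IsMeasurableRel E ∧ ∀ U : Set X, MeasurableSet U → ∀ ξ η η' : L2 μ, SupportedIn ξ U →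
    η' =ᵐ[μ] (nbhdSet E U).indicator η → inner ℂ ξ (T η) = inner ℂ ξ (T η')

/-- `T` has controlled support. -/
def HasControlledSupport [CoarseSpace X] {μ : Measure X} (T : L2 μ →L[ℂ] L2 μ) : Prop :=
  ∃ E : Set (X × X), CoarseSpace.IsControlled E ∧ IsSupportedOn T E

variable {μ}

lemma isSupportedOn_iff (T : L2 μ →L[ℂ] L2 μ) (E : Set (X × X)) (hE : IsMeasurableRel E) :
    IsSupportedOn T E ↔ ∀ U : Set X, MeasurableSet U → ∀ ζ : L2 μ,
      SupportedIn ζ (nbhdSet E U)ᶜ → SupportedIn (T ζ) Uᶜ := by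
  constructor
  · rintro ⟨-, h⟩ U hU ζ hζ
    set ξ : L2 μ := ((Lp.memLp (T ζ)).indicator hU).toLp _ with hξ
    have hξ' : ξ =ᵐ[μ] U.indicator (T ζ) := MemLp.coeFn_toLp _
    have hs : SupportedIn ξ U := by
      filter_upwards [hξ'] with x hx hxU
      rw [hx, indicator_of_notMem hxU]
    have h0 : ((0 : L2 μ) : X → ℂ) =ᵐ[μ] (nbhdSet E U).indicator ζ := by
      filter_upwards [Lp.coeFn_zero ℂ 2 μ, hζ] with x hx hx'
      rw [hx]
      by_cases hxE : x ∈ nbhdSet E U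
      · rw [indicator_of_mem hxE, hx' (by simpa using hxE)]; rfl
      · rw [indicator_of_notMem hxE]; rfl
    have h1 := h U hU ξ ζ 0 hs h0
    rw [map_zero, inner_zero_right] at h1
    have h2 : inner ℂ ξ ξ = inner ℂ ξ (T ζ) := by
      rw [L2.inner_def, L2.inner_def]
      apply integral_congr_ae
      filter_upwards [hξ'] with x hx
      rw [hx]
      by_cases hxU : x ∈ U
      · rw [indicator_of_mem hxU]
      · rw [indicator_of_notMem hxU]; simp
    rw [h1, inner_self_eq_zero] at h2
    have h3 : ξ =ᵐ[μ] (0 : X → ℂ) := by rw [h2]; exact Lp.coeFn_zero ℂ 2 μ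
    filter_upwards [hξ', h3] with x hx hx3 hxU
    have hxU' : x ∈ U := by simpa using hxU
    rw [hx3, indicator_of_mem hxU'] at hx
    exact hx.symm
  · intro h
    refine ⟨hE, fun U hU ξ η η' hξ hη' => ?_⟩
    have hz : SupportedIn (η - η') (nbhdSet E U)ᶜ := by
      filter_upwards [hη', Lp.coeFn_sub η η'] with x hx hx' hxE
      have hxE' : x ∈ nbhdSet E U := by simpa using hxE
      rw [hx', Pi.sub_apply, hx, indicator_of_mem hxE', sub_self]
    have h1 := h U hU _ hz
    rw [← sub_eq_zero, ← inner_sub_right, ← map_sub, L2.inner_def]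
    apply integral_eq_zero_of_ae
    filter_upwards [h1, hξ] with x hx hx'
    by_cases hxU : x ∈ U
    · rw [hx (by simpa using hxU)]; simp
    · rw [hx' hxU]; simp

lemma IsSupportedOn.mono {T : L2 μ →L[ℂ] L2 μ} {E F : Set (X × X)} (h : IsSupportedOn T E)
    (hF : IsMeasurableRel F) (hEF : E ⊆ F) : IsSupportedOn T F := by
  rw [isSupportedOn_iff _ _ hF]
  intro U hU ζ hζ
  refine (isSupportedOn_iff _ _ h.1).1 h U hU ζ ?_
  filter_upwards [hζ] with x hx hxE
  refine hx fun hc => hc ?_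
  have hxE' : x ∈ nbhdSet E U := by simpa using hxE
  obtain ⟨y, hy, hxy⟩ := mem_nbhdSet.1 hxE'
  exact mem_nbhdSet.2 ⟨y, hy, hEF hxy⟩

lemma IsSupportedOn.add {S T : L2 μ →L[ℂ] L2 μ} {E : Set (X × X)}
    (hS : IsSupportedOn S E) (hT : IsSupportedOn T E) : IsSupportedOn (S + T) E := by
  rw [isSupportedOn_iff _ _ hS.1]
  intro U hU ζ hζ
  have h1 := (isSupportedOn_iff _ _ hS.1).1 hS U hU ζ hζ
  have h2 := (isSupportedOn_iff _ _ hS.1).1 hT U hU ζ hζ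
  filter_upwards [h1, h2, Lp.coeFn_add (S ζ) (T ζ)] with x hx1 hx2 hx hxU
  rw [add_apply, hx, Pi.add_apply, hx1 hxU, hx2 hxU, add_zero]

lemma IsSupportedOn.mul {S T : L2 μ →L[ℂ] L2 μ} {E F : Set (X × X)}
    (hS : IsSupportedOn S E) (hT : IsSupportedOn T F) :
    IsSupportedOn (S * T) (compRel F E) := by
  have hm : IsMeasurableRel (compRel F E) := fun U hU => by
    rw [nbhdSet_compRel]; exact hT.1 _ (hS.1 _ hU)
  rw [isSupportedOn_iff _ _ hm]
  intro U hU ζ hζ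
  rw [nbhdSet_compRel] at hζ
  exact (isSupportedOn_iff _ _ hS.1).1 hS U hU _
    ((isSupportedOn_iff _ _ hT.1).1 hT _ (hS.1 _ hU) ζ hζ)

lemma IsSupportedOn.adjoint {T : L2 μ →L[ℂ] L2 μ} {E : Set (X × X)}
    (hT : IsSupportedOn T E) (hE : IsSymmRel E) :
    IsSupportedOn (ContinuousLinearMap.adjoint T) E := by
  refine ⟨hT.1, fun U hU ξ η η' hξ hη' => ?_⟩
  rw [ContinuousLinearMap.adjoint_inner_right, ContinuousLinearMap.adjoint_inner_right]
  have h1 : SupportedIn (T ξ) (nbhdSet E U)ᶜᶜ := by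
    refine (isSupportedOn_iff _ _ hT.1).1 hT _ (hT.1 U hU).compl ξ ?_
    filter_upwards [hξ] with x hx hxE
    refine hx fun hxU => ?_
    have hxE' : x ∈ nbhdSet E (nbhdSet E U)ᶜ := by simpa using hxE
    obtain ⟨w, hw, hxw⟩ := mem_nbhdSet.1 hxE'
    exact hw (mem_nbhdSet.2 ⟨x, hxU, (hE _ _).1 hxw⟩)
  rw [compl_compl] at h1
  rw [L2.inner_def, L2.inner_def]
  apply integral_congr_ae
  filter_upwards [h1, hη'] with x hx hx'
  by_cases hxE : x ∈ nbhdSet E U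
  · rw [hx', indicator_of_mem hxE]
  · rw [hx hxE]; simp

lemma isMeasurableRel_diagonal : IsMeasurableRel {p : X × X | p.1 = p.2} := fun U hU => by
  rw [nbhdSet_diagonal]; exact hU

lemma isSymmRel_diagonal : IsSymmRel {p : X × X | p.1 = p.2} := fun _ _ => eq_comm

/-- The multiplication operator `M_f` by `f ∈ L^∞`. -/
def mulOp (f : Lp ℂ ∞ μ) : L2 μ →L[ℂ] L2 μ :=
  (ContinuousLinearMap.mul ℂ ℂ).holderL μ ∞ 2 2 f

lemma isSupportedOn_mulOp (f : Lp ℂ ∞ μ) :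
    IsSupportedOn (mulOp f) {p : X × X | p.1 = p.2} := by
  rw [isSupportedOn_iff _ _ isMeasurableRel_diagonal]
  intro U _ ζ hζ
  rw [nbhdSet_diagonal] at hζ
  have h : mulOp f ζ =ᵐ[μ] fun x => f x * ζ x :=
    (ContinuousLinearMap.mul ℂ ℂ).coeFn_holder f ζ
  filter_upwards [hζ, h] with x hx hx' hxU
  rw [hx', hx hxU, mul_zero]

variable [CoarseSpace X]

lemma HasControlledSupport.add {S T : L2 μ →L[ℂ] L2 μ}
    (hS : HasControlledSupport S) (hT : HasControlledSupport T) :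
    HasControlledSupport (S + T) := by
  obtain ⟨E, hE, hSE⟩ := hS
  obtain ⟨F, hF, hTF⟩ := hT
  have hm : IsMeasurableRel (E ∪ F) := fun U hU => by
    rw [nbhdSet_union]; exact (hSE.1 U hU).union (hTF.1 U hU)
  exact ⟨E ∪ F, CoarseSpace.union hE hF,
    (hSE.mono hm subset_union_left).add (hTF.mono hm subset_union_right)⟩

lemma HasControlledSupport.mul {S T : L2 μ →L[ℂ] L2 μ}
    (hS : HasControlledSupport S) (hT : HasControlledSupport T) :
    HasControlledSupport (S * T) := by
  obtain ⟨E, hE, hSE⟩ := hS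
  obtain ⟨F, hF, hTF⟩ := hT
  exact ⟨compRel F E, CoarseSpace.comp hF hE, hSE.mul hTF⟩

lemma hasControlledSupport_algebraMap (c : ℂ) :
    HasControlledSupport (algebraMap ℂ (L2 μ →L[ℂ] L2 μ) c) := by
  refine ⟨_, CoarseSpace.diagonal, (isSupportedOn_iff _ _ isMeasurableRel_diagonal).2 ?_⟩
  intro U _ ζ hζ
  rw [nbhdSet_diagonal] at hζ
  have h : algebraMap ℂ (L2 μ →L[ℂ] L2 μ) c ζ = c • ζ := by
    simp [Algebra.algebraMap_eq_smul_one]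
  rw [h]
  filter_upwards [hζ, Lp.coeFn_smul c ζ] with x hx hx' hxU
  rw [hx', Pi.smul_apply, hx hxU, smul_zero]

variable (μ) in
/-- The unital `*`-algebra `ℂ_cs[X, μ]` of operators with controlled support. The condition on
`T†` only serves to have a `*`-algebra over an arbitrary measure; it is automatic in the situation
of interest, see `mem_controlledAlgebra_iff`. -/
def controlledAlgebra : StarSubalgebra ℂ (L2 μ →L[ℂ] L2 μ) where
  carrier := {T | HasControlledSupport T ∧ HasControlledSupport (star T)}
  mul_mem' := fun hS hT => ⟨hS.1.mul hT.1, by rw [star_mul]; exact hT.2.mul hS.2⟩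
  add_mem' := fun hS hT => ⟨hS.1.add hT.1, by rw [star_add]; exact hS.2.add hT.2⟩
  algebraMap_mem' := fun c => ⟨hasControlledSupport_algebraMap c, by
    rw [← algebraMap_star_comm]; exact hasControlledSupport_algebraMap _⟩
  star_mem' := fun hT => ⟨hT.2, by rw [star_star]; exact hT.1⟩

/-- A countable cover of `X` by sets `(F ∘ F)_i`, with `F` gordo. -/
lemma exists_countable_cover [MeasurableSingletonClass X] (hc : IsCountablyBounded X)
    (hμ : IsUniformlyBounded μ) {F : Set (X × X)} (hF : IsGordo μ F) :
    ∃ I : Set X, I.Countable ∧ ∀ x, ∃ i ∈ I, (x, i) ∈ compRel F F := by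
  obtain ⟨hFc, hFs, hFm, ε, hε, hFε⟩ := hF
  have hsing : ∀ x, nbhdSet F {x} = nbhd F x := fun x => by simp [nbhdSet]
  obtain ⟨I, hI⟩ := zorn_subset {I : Set X | I.PairwiseDisjoint (nbhd F)} (by
    intro c hc hchain
    refine ⟨⋃₀ c, ?_, fun s hs => subset_sUnion_of_mem hs⟩
    exact (pairwiseDisjoint_sUnion hchain.directedOn).2 fun s hs => hc hs)
  have hdisj : I.PairwiseDisjoint (nbhd F) := hI.prop
  refine ⟨I, ?_, ?_⟩
  · obtain ⟨B, hB, hBu⟩ := hc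
    have hfin : ∀ n, (I ∩ B n).Finite := by
      intro n
      by_contra hinf
      obtain ⟨C, hC⟩ := hμ (compRel (compRel F (B n ×ˢ B n)) F)
        (CoarseSpace.comp (CoarseSpace.comp hFc (hB n)) hFc)
      obtain ⟨k, hk⟩ := exists_nat_gt (C / ε)
      obtain ⟨t, htI, htk⟩ := Set.Infinite.exists_subset_card_eq hinf k
      have hmeas : ∀ i, MeasurableSet (nbhd F i) := fun i => by
        rw [← hsing]; exact hFm _ (measurableSet_singleton i)
      have h1 : μ (⋃ i ∈ t, nbhd F i) = ∑ i ∈ t, μ (nbhd F i) :=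
        measure_biUnion_finset (hdisj.subset fun i hi => (htI hi).1) fun i _ => hmeas i
      have h2 : μ (⋃ i ∈ t, nbhd F i) ≤ C := by
        refine hC _ (Finset.measurableSet_biUnion _ fun i _ => hmeas i) ?_
        rintro ⟨v, w⟩ ⟨hv, hw⟩
        simp only [mem_iUnion, nbhd, mem_ofPred_eq, exists_prop] at hv hw
        obtain ⟨i, hi, hvi⟩ := hv
        obtain ⟨j, hj, hwj⟩ := hw
        exact ⟨j, ⟨i, hvi, (htI hi).2, (htI hj).2⟩, (hFs _ _).1 hwj⟩
      have h3 : (t.card : ℝ≥0∞) * ε ≤ ∑ i ∈ t, μ (nbhd F i) := by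
        rw [← nsmul_eq_mul]
        exact Finset.card_nsmul_le_sum _ _ _ fun i _ => hFε i
      rw [← h1, htk] at h3
      have h4 : (k : ℝ≥0) * ε ≤ C := by exact_mod_cast h3.trans h2
      exact absurd h4 (not_le.2 ((div_lt_iff₀ hε).1 hk))
    have hIu : I = ⋃ n, I ∩ B n := by rw [← inter_iUnion, hBu, inter_univ]
    rw [hIu]
    exact countable_iUnion fun n => (hfin n).countable
  · intro x
    have hne : (nbhd F x).Nonempty := by
      by_contra h
      rw [not_nonempty_iff_eq_empty] at h
      have := hFε x
      rw [h, measure_empty] at this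
      exact absurd this (by simpa using hε.ne')
    by_cases hx : x ∈ I
    · obtain ⟨y, hy⟩ := hne
      exact ⟨x, hx, y, (hFs _ _).1 hy, hy⟩
    · by_contra hcon
      push Not at hcon
      refine hx (hI.le_of_ge (y := insert x I) ?_ (subset_insert _ _) (mem_insert _ _))
      refine hdisj.insert fun i hi _ => ?_
      rw [disjoint_left]
      intro y hy hy'
      exact hcon i hi ⟨y, (hFs _ _).1 hy, hy'⟩

/-- For a uniformly bounded measure with a gordo set on a space covered by countably many bounded
sets, `ℂ_cs[X, μ]` consists exactly of the operators with controlled support. -/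
theorem mem_controlledAlgebra_iff [MeasurableSingletonClass X] (hc : IsCountablyBounded X)
    (hμ : IsUniformlyBounded μ) (hg : ∃ F : Set (X × X), IsGordo μ F) (T : L2 μ →L[ℂ] L2 μ) :
    T ∈ controlledAlgebra μ ↔ HasControlledSupport T := by
  refine ⟨fun h => h.1, fun h => ⟨h, ?_⟩⟩
  obtain ⟨E, hE, hTE⟩ := h
  obtain ⟨F, hF⟩ := hg
  obtain ⟨I, hIc, hI⟩ := exists_countable_cover hc hμ hF
  obtain ⟨hFc, hFs, hFm, -⟩ := hF
  set G : Set (X × X) := compRel F F with hG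
  have hGc : CoarseSpace.IsControlled G := CoarseSpace.comp hFc hFc
  have hGm : ∀ i, MeasurableSet (nbhd G i) := fun i => by
    have h : nbhdSet G {i} = nbhd G i := by simp [nbhdSet]
    rw [← h, hG, nbhdSet_compRel]
    exact hFm _ (hFm _ (measurableSet_singleton i))
  let R : X → X → Prop := fun i j => ∃ a b, (a, i) ∈ G ∧ (b, j) ∈ G ∧ ((a, b) ∈ E ∨ (b, a) ∈ E)
  let E' : Set (X × X) := {p | ∃ i ∈ I, ∃ j ∈ I, (p.1, i) ∈ G ∧ (p.2, j) ∈ G ∧ R i j}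
  have hEE' : E ⊆ E' := by
    rintro ⟨x, y⟩ hxy
    obtain ⟨i, hi, hxi⟩ := hI x
    obtain ⟨j, hj, hyj⟩ := hI y
    exact ⟨i, hi, j, hj, hxi, hyj, x, y, hxi, hyj, Or.inl hxy⟩
  have hE's : IsSymmRel E' := by
    have key : ∀ x y, (x, y) ∈ E' → (y, x) ∈ E' := by
      rintro x y ⟨i, hi, j, hj, hx, hy, a, b, ha, hb, hab⟩
      exact ⟨j, hj, i, hi, hy, hx, b, a, hb, ha, hab.symm⟩
    exact fun x y => ⟨key x y, key y x⟩
  have hE'c : CoarseSpace.IsControlled E' := by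
    have hD := CoarseSpace.comp hGc (CoarseSpace.inverse hGc)
    refine CoarseSpace.subset (CoarseSpace.comp (CoarseSpace.comp hD
      (CoarseSpace.union hE (CoarseSpace.inverse hE))) hD) ?_
    rintro ⟨x, y⟩ ⟨i, -, j, -, hx, hy, a, b, ha, hb, hab⟩
    exact ⟨b, ⟨a, ⟨i, hx, ha⟩, hab⟩, ⟨j, hb, hy⟩⟩
  have hE'm : IsMeasurableRel E' := by
    intro U _
    have h : nbhdSet E' U = ⋃ i ∈ {i ∈ I | ∃ y ∈ U, ∃ j ∈ I, (y, j) ∈ G ∧ R i j}, nbhd G i := by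
      ext x
      simp only [mem_nbhdSet, mem_iUnion, exists_prop, nbhd, mem_ofPred_eq]
      constructor
      · rintro ⟨y, hy, i, hi, j, hj, hxi, hyj, hR⟩
        exact ⟨i, ⟨hi, y, hy, j, hj, hyj, hR⟩, hxi⟩
      · rintro ⟨i, ⟨hi, y, hy, j, hj, hyj, hR⟩, hxi⟩
        exact ⟨y, hy, i, hi, j, hj, hxi, hyj, hR⟩
    rw [h]
    exact MeasurableSet.biUnion (hIc.mono fun i hi => hi.1) fun i _ => hGm i
  exact ⟨E', hE'c, (hTE.mono hE'm hEE').adjoint hE's⟩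

/-- `M_f` as an element of `ℂ_cs[X, μ]`. -/
def mulElem (f : Lp ℂ ∞ μ) : controlledAlgebra μ :=
  ⟨mulOp f, ⟨_, CoarseSpace.diagonal, isSupportedOn_mulOp f⟩,
    ⟨_, CoarseSpace.diagonal, (isSupportedOn_mulOp f).adjoint isSymmRel_diagonal⟩⟩

variable (μ) in
/-- Measurable functions that are square integrable on each bounded measurable set. -/
def IsLocallyL2 (φ : X → ℂ) : Prop :=
  AEStronglyMeasurable φ μ ∧
    ∀ U : Set X, MeasurableSet U → IsBoundedSet U → MemLp φ 2 (μ.restrict U)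

/-- `ξ ∈ L²` has bounded support. -/
def HasBoundedSupport (ξ : L2 μ) : Prop :=
  ∃ U : Set X, MeasurableSet U ∧ IsBoundedSet U ∧ SupportedIn ξ U

/-- `Φ(T) = φ`, where `Φ(T) = T(1)` and `T` acts on locally `L²` functions as the dual of `T†`
acting on the `L²` functions with bounded support: `⟨ξ, φ⟩ = ⟨T† ξ, 1⟩` for all such `ξ`. -/
def IsPhi (T : L2 μ →L[ℂ] L2 μ) (φ : X → ℂ) : Prop :=
  IsLocallyL2 μ φ ∧ ∀ ξ : L2 μ, HasBoundedSupport ξ →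
    ∫ x, star (ξ x) * φ x ∂μ = ∫ x, star (ContinuousLinearMap.adjoint T ξ x) ∂μ

variable (μ) in
/-- `(E, ε)`-blocking collections of measurable sets. -/
def IsBlocking (E : Set (X × X)) (ε : ℝ) (𝒜 : Set (Set X)) : Prop :=
  (∀ A ∈ 𝒜, MeasurableSet A) ∧ (∀ A ∈ 𝒜, A ×ˢ A ⊆ E) ∧ 𝒜.PairwiseDisjoint id ∧
    ∀ A ∈ 𝒜, ENNReal.ofReal ε ≤ μ A

/-- `T` is an operator in `(E, ε)`-blocks: it is supported on `⋃ A × A` with `A` ranging over some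
`(E, ε)`-blocking collection. -/
def IsInBlocks (E : Set (X × X)) (ε : ℝ) (T : L2 μ →L[ℂ] L2 μ) : Prop :=
  ∃ 𝒜 : Set (Set X), IsBlocking μ E ε 𝒜 ∧ IsSupportedOn T (⋃ A ∈ 𝒜, A ×ˢ A)

/-- The subspace `H_c` of constant vectors of a unital `*`-representation of `ℂ_cs[X, μ]`: those
`v` with `T v = M_{Φ(T)} v` for every `T` for which `Φ(T)` is bounded. -/
def constantVectors {H : Type u} [NormedAddCommGroup H] [InnerProductSpace ℂ H] [CompleteSpace H]
    (ρ : controlledAlgebra μ →⋆ₐ[ℂ] (H →L[ℂ] H)) : Submodule ℂ H where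
  carrier := {v | ∀ (T : controlledAlgebra μ) (f : Lp ℂ ∞ μ), IsPhi (T : L2 μ →L[ℂ] L2 μ) f →
    ρ T v = ρ (mulElem f) v}
  add_mem' := fun hv hw T f h => by rw [map_add, map_add, hv T f h, hw T f h]
  zero_mem' := fun T f _ => by rw [map_zero, map_zero]
  smul_mem' := fun c v hv T f h => by rw [map_smul, map_smul, hv T f h]

variable (μ) in
/-- Geometric property (T) of `(X, μ)`. The norm on `T` is the operator norm on `L²(X, μ)`. The
zero operator has to be excluded, as it satisfies all the other conditions. It is enough to let `H`
range over the universe of `X`: the condition on `v` may be checked in the closed subspace generated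
by `v`, which is a completion of a quotient of `ℂ_cs[X, μ]`. -/
def GeometricPropertyT : Prop :=
  ∃ (E : Set (X × X)) (ε γ : ℝ), CoarseSpace.IsControlled E ∧ 0 < ε ∧ 0 < γ ∧
    ∀ (H : Type u) [NormedAddCommGroup H] [InnerProductSpace ℂ H] [CompleteSpace H]
      (ρ : controlledAlgebra μ →⋆ₐ[ℂ] (H →L[ℂ] H)),
      ∀ v ∈ (constantVectors ρ)ᗮ, ‖v‖ = 1 →
        ∃ T : controlledAlgebra μ, T ≠ 0 ∧ IsInBlocks E ε (T : L2 μ →L[ℂ] L2 μ) ∧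
          ∃ f : Lp ℂ ∞ μ, IsPhi (T : L2 μ →L[ℂ] L2 μ) f ∧
            γ * ‖(T : L2 μ →L[ℂ] L2 μ)‖ ≤ ‖(ρ T - ρ (mulElem f)) v‖

end Operators

end Coarse

open Coarse

/-! Both spaces are compared through a common countable discretisation `I`. Each of `X` and `X'` is
cut into measurable fibres over `I`, of measure bounded above and away from zero, and the coarse
structure is read off from `I`. On `L²` this leaves commuting projections `q S` and the indicators
`one S` of finitely many fibres (`BlockSpace`). Controlled support and boundedness of `Φ(T)` become
statements about blocks: `Φ(T) = f` amounts to `T - M_f` killing the constant function (`KillsOne`).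

Averaging over the fibres on one side and transplanting the means to the other side gives a block
diagonal operator `lift : L²(μ') → L²(μ)` that fixes constants. It is in general neither injective
nor surjective, so representations cannot be conjugated by it. Instead, a representation `ρ` of
`ℂ_cs[X']` with a vector `v` is induced to `ℂ_cs[X]`: the controlled operators `x : L²(μ') → L²(μ)`
carry the form `⟨x, y⟩ = ⟨v, ρ(x†y)v⟩`, and `ℂ_cs[X]` acts by composition. Positivity comes from
`exists_block_squares`: a colouring of `I` writes `x†x` as finitely many squares of self-adjoint
operators in blocks. Boundedness of the action comes from a second colouring, which cuts a
controlled operator into pieces `d` with `d†d` block diagonal, so that `‖d‖² - d†d` is again of the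
form `s†s`.

For the transfer, let `v` be a unit vector orthogonal to the constant vectors of `ρ` that is almost
fixed by all operators in blocks on `X'`. The class of `lift` in the induced representation splits
as `z + w`, with `z` constant and `w` orthogonal to the constant vectors. Composing with the reverse
lift and evaluating at `v` sends `z` to a constant vector of `ρ`, which is orthogonal to `v`, and
sends the class of `lift` close to `v`; hence `w` is not small. Property (T) on `X` yields a block
operator `T` that moves `w` by at least `γ‖T‖‖w‖`. With `x = (T - M_f) lift`, the squared
displacement is `⟨v, ρ(x†x)v⟩`, a sum of boundedly many terms `‖ρ(y_k)v‖²` with `y_k` in blocks on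
`X'` and killing constants. These are small by assumption, a contradiction. The estimate needs `‖x‖
≤ C‖T‖` although `‖f‖_∞` is not bounded by `‖T‖`: the lift takes values in functions constant on
fibres, so only the `L²` norms of `f` over fibres matter. -/

namespace Coarse

open Filter
open scoped InnerProduct

/-! ### Block spaces: support, constants and square roots -/

noncomputable section BlockSpaces

/-- A Hilbert space with a finitely additive projection-valued measure on the subsets of `I`,
and vectors `one S` that play the role of the indicator functions of the finite sets `S`. -/
structure BlockSpace (I : Type*) (L : Type*) [NormedAddCommGroup L] [InnerProductSpace ℂ L]
    [CompleteSpace L] where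
  q : Set I → L →L[ℂ] L
  q_inter : ∀ S T, q S * q T = q (S ∩ T)
  q_univ : q univ = 1
  q_union : ∀ S T, Disjoint S T → q (S ∪ T) = q S + q T
  q_star : ∀ S, IsSelfAdjoint (q S)
  one : Finset I → L
  -- The intersection enters through a separate `U`, which avoids decidability of membership in `S`.
  q_one : ∀ (S : Set I) (T U : Finset I), (U : Set I) = S ∩ T → q S (one T) = one U

variable {I : Type*} {L M N : Type*}
  [NormedAddCommGroup L] [InnerProductSpace ℂ L] [CompleteSpace L]
  [NormedAddCommGroup M] [InnerProductSpace ℂ M] [CompleteSpace M]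
  [NormedAddCommGroup N] [InnerProductSpace ℂ N] [CompleteSpace N]

namespace BlockSpace

variable (P : BlockSpace I L)

lemma q_apply_q (S T : Set I) (ξ : L) : P.q S (P.q T ξ) = P.q (S ∩ T) ξ := by
  rw [← P.q_inter]; rfl

@[simp] lemma q_empty : P.q ∅ = 0 := by
  simpa using P.q_union ∅ ∅ (by simp)

lemma q_add_compl (S : Set I) : P.q S + P.q Sᶜ = 1 := by
  rw [← P.q_union _ _ disjoint_compl_right, union_compl_self, P.q_univ]

lemma q_add_compl_apply (S : Set I) (ξ : L) : P.q S ξ + P.q Sᶜ ξ = ξ := by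
  have := congrArg (fun T : L →L[ℂ] L => T ξ) (P.q_add_compl S)
  simpa using this

lemma inner_q_left (S : Set I) (ξ η : L) : inner ℂ (P.q S ξ) η = inner ℂ ξ (P.q S η) := by
  rw [← ContinuousLinearMap.adjoint_inner_right,
    (ContinuousLinearMap.isSelfAdjoint_iff').1 (P.q_star S)]

lemma adjoint_q (S : Set I) : (P.q S)† = P.q S :=
  (ContinuousLinearMap.isSelfAdjoint_iff').1 (P.q_star S)

lemma norm_q_apply_le (S : Set I) (ξ : L) : ‖P.q S ξ‖ ≤ ‖ξ‖ := by
  have h : ‖P.q S ξ‖ ^ 2 ≤ ‖P.q S ξ‖ * ‖ξ‖ := by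
    rw [← inner_self_eq_norm_sq (𝕜 := ℂ), P.inner_q_left, P.q_apply_q, inter_self,
      ← P.inner_q_left]
    exact re_inner_le_norm _ _
  by_contra hc
  push Not at hc
  nlinarith [norm_nonneg ξ, norm_nonneg (P.q S ξ)]

lemma norm_q_le (S : Set I) : ‖P.q S‖ ≤ 1 :=
  ContinuousLinearMap.opNorm_le_bound _ zero_le_one fun ξ => by
    simpa using P.norm_q_apply_le S ξ

/-- Finite additivity over the fibres of a map to a finite type. -/
lemma sum_q_fiber {κ : Type*} [Fintype κ] (χ : I → κ) :
    ∑ k, P.q {i | χ i = k} = 1 := by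
  classical
  have h : ∀ s : Finset κ, ∑ k ∈ s, P.q {i | χ i = k} = P.q {i | χ i ∈ s} := by
    intro s
    induction s using Finset.induction_on with
    | empty => simp
    | insert a s ha ih =>
      rw [Finset.sum_insert ha, ih, ← P.q_union]
      · congr 1; ext i; simp
      · rw [disjoint_left]
        rintro i rfl hi
        exact ha hi
  rw [h, ← P.q_univ]
  congr 1; ext i; simp

lemma norm_sq_add_of_disjoint {S T : Set I} (h : Disjoint S T) (ξ : L) :
    ‖P.q (S ∪ T) ξ‖ ^ 2 = ‖P.q S ξ‖ ^ 2 + ‖P.q T ξ‖ ^ 2 := by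
  have h0 : inner ℂ (P.q S ξ) (P.q T ξ) = 0 := by
    rw [P.inner_q_left, P.q_apply_q, h.inter_eq]; simp
  rw [P.q_union _ _ h, add_apply, sq, sq, sq]
  exact norm_add_sq_eq_norm_sq_add_norm_sq_of_inner_eq_zero _ _ h0

lemma sum_norm_q_sq_le (P : BlockSpace I L) (S : Finset I) (ξ : L) :
    ∑ i ∈ S, ‖P.q {i} ξ‖ ^ 2 ≤ ‖ξ‖ ^ 2 := by
  classical
  have h : ∑ i ∈ S, ‖P.q {i} ξ‖ ^ 2 = ‖P.q S ξ‖ ^ 2 := by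
    induction S using Finset.induction_on with
    | empty => simp
    | insert a s ha ih =>
      rw [Finset.sum_insert ha, ih, Finset.coe_insert, insert_eq, P.norm_sq_add_of_disjoint]
      simpa using ha
  rw [h]
  exact pow_le_pow_left₀ (norm_nonneg _) (P.norm_q_apply_le _ _) 2

end BlockSpace

/-- `x` vanishes between the blocks outside of `E`. -/
def BlockSupp (P : BlockSpace I L) (Q : BlockSpace I M) (x : L →L[ℂ] M) (E : Set (I × I)) : Prop :=
  ∀ S T : Set I, (∀ i ∈ S, ∀ j ∈ T, (i, j) ∉ E) → ∀ ξ, Q.q S (x (P.q T ξ)) = 0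

/-- `x` annihilates the constant function. -/
def KillsOne (P : BlockSpace I L) (Q : BlockSpace I M) (x : L →L[ℂ] M) : Prop :=
  ∀ i, ∀ᶠ S : Finset I in atTop, Q.q {i} (x (P.one S)) = 0

section Supp

variable {P : BlockSpace I L} {Q : BlockSpace I M} {R : BlockSpace I N}

lemma BlockSupp.mono {x : L →L[ℂ] M} {E F : Set (I × I)} (h : BlockSupp P Q x E) (hEF : E ⊆ F) :
    BlockSupp P Q x F := fun S T hST => h S T fun i hi j hj hij => hST i hi j hj (hEF hij)

lemma BlockSupp.add {x y : L →L[ℂ] M} {E : Set (I × I)} (hx : BlockSupp P Q x E)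
    (hy : BlockSupp P Q y E) : BlockSupp P Q (x + y) E := fun S T hST ξ => by
  rw [add_apply, map_add, hx S T hST, hy S T hST, add_zero]

lemma BlockSupp.sub {x y : L →L[ℂ] M} {E : Set (I × I)} (hx : BlockSupp P Q x E)
    (hy : BlockSupp P Q y E) : BlockSupp P Q (x - y) E := fun S T hST ξ => by
  rw [sub_apply, map_sub, hx S T hST, hy S T hST, sub_zero]

lemma BlockSupp.smul {x : L →L[ℂ] M} {E : Set (I × I)} (hx : BlockSupp P Q x E) (c : ℂ) :
    BlockSupp P Q (c • x) E := fun S T hST ξ => by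
  rw [smul_apply, map_smul, hx S T hST, smul_zero]

lemma blockSupp_zero (E : Set (I × I)) : BlockSupp P Q (0 : L →L[ℂ] M) E := fun S T _ ξ => by
  rw [zero_apply, map_zero]

/-- Locality: the rows in `S` only see the columns that `E` joins to `S`. The next lemma is the dual
statement for columns. -/
lemma BlockSupp.apply_eq {x : L →L[ℂ] M} {E : Set (I × I)} (hx : BlockSupp P Q x E) {S T : Set I}
    (hST : ∀ i ∈ S, ∀ j, (i, j) ∈ E → j ∈ T) (ξ : L) :
    Q.q S (x ξ) = Q.q S (x (P.q T ξ)) := by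
  conv_lhs => rw [← P.q_add_compl_apply T ξ]
  rw [map_add, map_add, hx S Tᶜ (fun i hi j hj hij => hj (hST i hi j hij)), add_zero]

lemma BlockSupp.apply_q {x : L →L[ℂ] M} {E : Set (I × I)} (hx : BlockSupp P Q x E) {S T : Set I}
    (hST : ∀ i, ∀ j ∈ T, (i, j) ∈ E → i ∈ S) (ξ : L) :
    x (P.q T ξ) = Q.q S (x (P.q T ξ)) := by
  conv_lhs => rw [← Q.q_add_compl_apply S (x (P.q T ξ))]
  rw [hx Sᶜ T (fun i hi j hj hij => hi (hST i j hj hij)), add_zero]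

lemma BlockSupp.comp {x : L →L[ℂ] M} {y : M →L[ℂ] N} {E F : Set (I × I)}
    (hy : BlockSupp Q R y F) (hx : BlockSupp P Q x E) :
    BlockSupp P R (y ∘L x) (compRel F E) := fun S T hST ξ => by
  rw [ContinuousLinearMap.comp_apply,
    hy.apply_eq (T := {j | ∃ i ∈ S, (i, j) ∈ F}) (fun i hi j hij => ⟨i, hi, hij⟩), hx, map_zero,
    map_zero]
  rintro j ⟨i, hi, hij⟩ k hk hjk
  exact hST i hi k hk ⟨j, hij, hjk⟩

lemma BlockSupp.adjoint {x : L →L[ℂ] M} {E : Set (I × I)} (hx : BlockSupp P Q x E) :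
    BlockSupp Q P (x†) {p | (p.2, p.1) ∈ E} := fun S T hST ξ => by
  refine ext_inner_left ℂ fun η => ?_
  rw [← P.inner_q_left, ContinuousLinearMap.adjoint_inner_right, ← Q.inner_q_left,
    hx T S (fun i hi j hj => hST j hj i hi), inner_zero_left, inner_zero_right]

lemma blockSupp_q (S : Set I) : BlockSupp P P (P.q S) {p | p.1 = p.2} := fun A B hAB ξ => by
  rw [P.q_apply_q, P.q_apply_q]
  have : A ∩ S ∩ B = ∅ := by
    ext i
    simp only [mem_inter_iff, mem_empty_iff_false, iff_false]
    rintro ⟨⟨h1, -⟩, h2⟩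
    exact hAB i h1 i h2 rfl
  rw [this]; simp

lemma blockSupp_one : BlockSupp P P (1 : L →L[ℂ] L) {p | p.1 = p.2} := by
  rw [← P.q_univ]; exact blockSupp_q _

lemma BlockSupp.q_conj {x : L →L[ℂ] M} {E : Set (I × I)} (hx : BlockSupp P Q x E) (A B : Set I) :
    BlockSupp P Q (Q.q A ∘L x ∘L P.q B) {p ∈ E | p.1 ∈ A ∧ p.2 ∈ B} := fun S T hST ξ => by
  simp only [ContinuousLinearMap.comp_apply]
  rw [P.q_apply_q, Q.q_apply_q]
  refine hx _ _ ?_ _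
  rintro i ⟨hi, hiA⟩ j ⟨hjB, hj⟩ hij
  exact hST i hi j hj ⟨hij, hiA, hjB⟩

lemma compRel_diagonal (E : Set (I × I)) : compRel E {p | p.1 = p.2} = E := by
  ext ⟨a, b⟩; simp [compRel]

/-- Positive square roots stay supported on an equivalence relation. -/
lemma BlockSupp.sqrt {b : L →L[ℂ] L} {r : Set (I × I)} (hb : BlockSupp P P b r)
    (hr : ∀ i, (i, i) ∈ r) (hs : ∀ i j, (i, j) ∈ r → (j, i) ∈ r)
    (ht : ∀ i j k, (i, j) ∈ r → (j, k) ∈ r → (i, k) ∈ r) :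
    BlockSupp P P (CFC.sqrt b) r := by
  intro S T hST ξ
  -- `U` is the saturation of `S`. It is a union of classes, so `q U` commutes with `b` and
  -- therefore with its square root.
  set U : Set I := {j | ∃ i ∈ S, (i, j) ∈ r} with hU
  have hcomm : Commute b (P.q U) := by
    refine ContinuousLinearMap.ext fun η => ?_
    change b (P.q U η) = P.q U (b η)
    refine (hb.apply_q (S := U) ?_ η).trans (hb.apply_eq (T := U) ?_ η).symm
    · rintro i j ⟨k, hk, hkj⟩ hij
      exact ⟨k, hk, ht _ _ _ hkj (hs _ _ hij)⟩
    · rintro i ⟨k, hk, hki⟩ j hij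
      exact ⟨k, hk, ht _ _ _ hki hij⟩
  have hc : Commute (CFC.sqrt b) (P.q U) := hcomm.cfcₙ_nnreal _
  have hc' : ∀ η, CFC.sqrt b (P.q U η) = P.q U (CFC.sqrt b η) := fun η =>
    congrArg (fun T : L →L[ℂ] L => T η) hc
  have h1 : S ∩ U = S := inter_eq_left.2 fun i hi => ⟨i, hi, hr i⟩
  have h2 : U ∩ T = ∅ := by
    ext j
    simp only [mem_inter_iff, mem_empty_iff_false, iff_false]
    rintro ⟨⟨i, hi, hij⟩, hj⟩
    exact hST i hi j hj hij
  rw [← h1, ← P.q_apply_q, ← hc', P.q_apply_q, h2]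
  simp

/-- If `d† d` is block diagonal, then so is a square root of `‖d‖² - d† d`. -/
lemma exists_diagonal_complement {d : L →L[ℂ] M}
    (hd : BlockSupp P P (d† ∘L d) {p | p.1 = p.2}) :
    ∃ s : L →L[ℂ] L, BlockSupp P P s {p | p.1 = p.2} ∧
      s† ∘L s + d† ∘L d = ((‖d‖ ^ 2 : ℝ) : ℂ) • (1 : L →L[ℂ] L) := by
  set c : L →L[ℂ] L := ((‖d‖ ^ 2 : ℝ) : ℂ) • (1 : L →L[ℂ] L) - d† ∘L d with hc
  have hcs : BlockSupp P P c {p | p.1 = p.2} := (blockSupp_one.smul _).sub hd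
  have hc0 : 0 ≤ c := by
    rw [ContinuousLinearMap.nonneg_iff_isPositive, ContinuousLinearMap.isPositive_iff_complex]
    intro ξ
    have h1 : inner ℂ (c ξ) ξ = ((‖d‖ ^ 2 * ‖ξ‖ ^ 2 - ‖d ξ‖ ^ 2 : ℝ) : ℂ) := by
      rw [hc, sub_apply, inner_sub_left, ContinuousLinearMap.comp_apply,
        ContinuousLinearMap.adjoint_inner_left, smul_apply, inner_smul_left,
        one_apply_eq_self, inner_self_eq_norm_sq_to_K, inner_self_eq_norm_sq_to_K]
      simp
    rw [h1]
    refine ⟨by simp only [RCLike.re_to_complex, Complex.ofReal_re], ?_⟩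
    simp only [RCLike.re_to_complex, Complex.ofReal_re]
    have := d.le_opNorm ξ
    nlinarith [norm_nonneg (d ξ), norm_nonneg ξ, norm_nonneg d,
      mul_self_le_mul_self (norm_nonneg (d ξ)) this]
  refine ⟨CFC.sqrt c, hcs.sqrt (fun _ => rfl) (fun _ _ h => h.symm) (fun _ _ _ h h' => h.trans h'),
    ?_⟩
  have hsa : (CFC.sqrt c)† = CFC.sqrt c :=
    (ContinuousLinearMap.isSelfAdjoint_iff').1 (CFC.sqrt_nonneg c).isSelfAdjoint
  have h2 : (CFC.sqrt c)† ∘L CFC.sqrt c = c := by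
    rw [hsa]; exact CFC.sqrt_mul_sqrt_self c hc0
  rw [h2, hc, sub_add_cancel]

end Supp

section Kills

variable {P : BlockSpace I L} {Q : BlockSpace I M} {R : BlockSpace I N}

lemma BlockSpace.q_eq_zero_of_finite (P : BlockSpace I L) {S : Set I} (hS : S.Finite) {ξ : L}
    (h : ∀ i ∈ S, P.q {i} ξ = 0) : P.q S ξ = 0 := by
  induction S, hS using Set.Finite.induction_on with
  | empty => simp
  | @insert a s ha _ ih =>
    rw [insert_eq, P.q_union _ _ (by simpa using ha), add_apply, h a (mem_insert _ _),
      ih fun i hi => h i (mem_insert_of_mem _ hi), add_zero]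

lemma BlockSpace.eventually_q_one (P : BlockSpace I L) {S : Set I} (hS : S.Finite) :
    ∀ᶠ T : Finset I in atTop, P.q S (P.one T) = P.one hS.toFinset := by
  filter_upwards [eventually_ge_atTop hS.toFinset] with T hT
  refine P.q_one _ _ _ ?_
  ext i
  simp only [Finite.coe_toFinset, mem_inter_iff, Finset.mem_coe]
  exact ⟨fun h => ⟨h, hT (by simpa using h)⟩, fun h => h.1⟩

/-- A row of `y` involves only finitely many blocks, and on each of them `x (one S)` vanishes for
large `S`. -/
lemma KillsOne.comp {x : L →L[ℂ] M} {y : M →L[ℂ] N} {F : Set (I × I)} (hx : KillsOne P Q x)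
    (hy : BlockSupp Q R y F) (hF : ∀ i, {j | (i, j) ∈ F}.Finite) : KillsOne P R (y ∘L x) := by
  intro i
  have h : ∀ᶠ S : Finset I in atTop, ∀ j ∈ {j | (i, j) ∈ F}, Q.q {j} (x (P.one S)) = 0 :=
    (hF i).eventually_all.2 fun j _ => hx j
  filter_upwards [h] with S hS
  rw [ContinuousLinearMap.comp_apply, hy.apply_eq (T := {j | (i, j) ∈ F}) (by simp),
    Q.q_eq_zero_of_finite (hF i) hS, map_zero, map_zero]

lemma KillsOne.comp_one {x : L →L[ℂ] M} {y : M →L[ℂ] N} (hy : KillsOne Q R y)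
    (hx : ∀ S, x (P.one S) = Q.one S) : KillsOne P R (y ∘L x) := by
  intro i
  filter_upwards [hy i] with S hS
  rw [ContinuousLinearMap.comp_apply, hx, hS]

end Kills

end BlockSpaces

/-! ### Colourings and sums of squares in blocks -/

noncomputable section Decomposition

/-- Greedy colouring of a countable graph of bounded degree. -/
lemma exists_coloring {I : Type*} [Countable I] (G : I → I → Prop) (hG : ∀ i j, G i j → G j i)
    (N : ℕ) (hN : ∀ i, {j | G i j}.encard ≤ N) :
    ∃ χ : I → Fin (N + 1), ∀ i j, G i j → χ i = χ j → i = j := by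
  classical
  obtain ⟨e, he⟩ := Countable.exists_injective_nat I
  let wf : WellFounded (fun i j : I => e i < e j) := InvImage.wf e Nat.lt_wfRel.wf
  let F : (i : I) → ((j : I) → e j < e i → Fin (N + 1)) → Fin (N + 1) := fun i rec =>
    -- The default colour `0` is never used: at most `N` neighbours cannot exhaust `N + 1` colours.
    if h : ∃ c, ∀ (j : I) (hj : e j < e i), G i j → rec j hj ≠ c then h.choose else 0
  let χ : I → Fin (N + 1) := wf.fix F
  have hχ : ∀ i j, e j < e i → G i j → χ j ≠ χ i := by
    intro i
    have h : ∃ c, ∀ (j : I) (hj : e j < e i), G i j → χ j ≠ c := by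
      by_contra hc
      push Not at hc
      have h1 : (univ : Set (Fin (N + 1))) ⊆ χ '' {j | G i j} := fun c _ => by
        obtain ⟨j, -, hj, hjc⟩ := hc c
        exact ⟨j, hj, hjc⟩
      have h2 := (encard_le_encard h1).trans ((encard_image_le _ _).trans (hN i))
      rw [encard_univ, ENat.card_eq_coe_fintype_card, Fintype.card_fin] at h2
      have h3 : N + 1 ≤ N := by exact_mod_cast h2
      omega
    have h1 : χ i = h.choose := by
      change wf.fix F i = _
      rw [wf.fix_eq]
      exact dif_pos h
    rw [h1]
    exact h.choose_spec
  refine ⟨χ, fun i j hij hc => ?_⟩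
  rcases lt_trichotomy (e i) (e j) with h | h | h
  · exact absurd hc (hχ j i h (hG i j hij))
  · exact he h
  · exact absurd hc.symm (hχ i j h hij)

/-- The sections of every controlled set are finite, of uniformly bounded cardinality. -/
def IsUniformlyLocallyFinite (I : Type*) [CoarseSpace I] : Prop :=
  ∀ E : Set (I × I), CoarseSpace.IsControlled E → ∃ N : ℕ, ∀ i, {j | (i, j) ∈ E}.encard ≤ N

lemma IsUniformlyLocallyFinite.finite {I : Type*} [CoarseSpace I]
    (h : IsUniformlyLocallyFinite I) {E : Set (I × I)} (hE : CoarseSpace.IsControlled E) (i : I) :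
    {j | (i, j) ∈ E}.Finite := by
  obtain ⟨N, hN⟩ := h E hE
  exact finite_of_encard_le_coe (hN i)

/-- The pairs of points that lie in a common section of `K`, and the diagonal. -/
def spread {I : Type*} (K : Set (I × I)) : Set (I × I) :=
  compRel {p | (p.2, p.1) ∈ K} K ∪ {p | p.1 = p.2}

lemma isControlled_spread {I : Type*} [CoarseSpace I] {K : Set (I × I)}
    (hK : CoarseSpace.IsControlled K) : CoarseSpace.IsControlled (spread K) :=
  CoarseSpace.union (CoarseSpace.comp (CoarseSpace.inverse hK) hK) CoarseSpace.diagonal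

variable {I : Type*} [CoarseSpace I] {L M N : Type*}
  [NormedAddCommGroup L] [InnerProductSpace ℂ L] [CompleteSpace L]
  [NormedAddCommGroup M] [InnerProductSpace ℂ M] [CompleteSpace M]
  [NormedAddCommGroup N] [InnerProductSpace ℂ N] [CompleteSpace N]
  {P : BlockSpace I L} {Q : BlockSpace I M} {R : BlockSpace I N}

/-- Operators with controlled support between block spaces. -/
def ControlledOp (P : BlockSpace I L) (Q : BlockSpace I M) (x : L →L[ℂ] M) : Prop :=
  ∃ E : Set (I × I), CoarseSpace.IsControlled E ∧ BlockSupp P Q x E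

lemma ControlledOp.add {x y : L →L[ℂ] M} (hx : ControlledOp P Q x) (hy : ControlledOp P Q y) :
    ControlledOp P Q (x + y) := by
  obtain ⟨E, hE, hx⟩ := hx
  obtain ⟨F, hF, hy⟩ := hy
  exact ⟨E ∪ F, CoarseSpace.union hE hF,
    (hx.mono subset_union_left).add (hy.mono subset_union_right)⟩

lemma ControlledOp.smul {x : L →L[ℂ] M} (hx : ControlledOp P Q x) (c : ℂ) :
    ControlledOp P Q (c • x) := by
  obtain ⟨E, hE, hx⟩ := hx
  exact ⟨E, hE, hx.smul c⟩

lemma controlledOp_zero : ControlledOp P Q (0 : L →L[ℂ] M) :=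
  ⟨_, CoarseSpace.diagonal, blockSupp_zero _⟩

lemma ControlledOp.comp {x : L →L[ℂ] M} {y : M →L[ℂ] N} (hy : ControlledOp Q R y)
    (hx : ControlledOp P Q x) : ControlledOp P R (y ∘L x) := by
  obtain ⟨E, hE, hx⟩ := hx
  obtain ⟨F, hF, hy⟩ := hy
  exact ⟨_, CoarseSpace.comp hF hE, hy.comp hx⟩

lemma ControlledOp.adjoint {x : L →L[ℂ] M} (hx : ControlledOp P Q x) :
    ControlledOp Q P (x†) := by
  obtain ⟨E, hE, hx⟩ := hx
  exact ⟨_, CoarseSpace.inverse hE, hx.adjoint⟩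

lemma controlledOp_q (S : Set I) : ControlledOp P P (P.q S) :=
  ⟨_, CoarseSpace.diagonal, blockSupp_q S⟩

lemma KillsOne.controlled_comp (hI : IsUniformlyLocallyFinite I) {x : L →L[ℂ] M} {y : M →L[ℂ] N}
    (hx : KillsOne P Q x) (hy : ControlledOp Q R y) : KillsOne P R (y ∘L x) := by
  obtain ⟨F, hF, hy⟩ := hy
  exact hx.comp hy (hI.finite hF)

lemma nonneg_adjoint_comp_self (x : L →L[ℂ] M) : 0 ≤ x† ∘L x :=
  (ContinuousLinearMap.nonneg_iff_isPositive _).2 (ContinuousLinearMap.isPositive_adjoint_comp_self x)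

/-- On the finite class `B` of `i` the indicator is a genuine vector with `b 1_B = 0`, so `‖√b 1_B‖²
= ⟨1_B, b 1_B⟩ = 0`. -/
lemma KillsOne.sqrt (hI : IsUniformlyLocallyFinite I) {b : L →L[ℂ] L} {r : Set (I × I)}
    (hb0 : 0 ≤ b) (hb : BlockSupp P P b r) (hrc : CoarseSpace.IsControlled r)
    (hr : ∀ i, (i, i) ∈ r) (hs : ∀ i j, (i, j) ∈ r → (j, i) ∈ r)
    (ht : ∀ i j k, (i, j) ∈ r → (j, k) ∈ r → (i, k) ∈ r) (hk : KillsOne P P b) :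
    KillsOne P P (CFC.sqrt b) := by
  intro i
  set B : Set I := {j | (i, j) ∈ r} with hB
  have hBf : B.Finite := hI.finite hrc i
  have h1 : b (P.one hBf.toFinset) = 0 := by
    have h : ∀ᶠ S : Finset I in atTop, ∀ j ∈ B, P.q {j} (b (P.one S)) = 0 :=
      hBf.eventually_all.2 fun j _ => hk j
    obtain ⟨S, hS, hSB⟩ := (h.and (P.eventually_q_one hBf)).exists
    rw [← hSB, hb.apply_q (S := B), ← hb.apply_eq]
    · exact P.q_eq_zero_of_finite hBf hS
    · exact fun j hj k hjk => ht _ _ _ hj hjk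
    · exact fun j k hk hjk => ht _ _ _ hk (hs _ _ hjk)
  have h2 : CFC.sqrt b (P.one hBf.toFinset) = 0 := by
    have hsa : (CFC.sqrt b)† = CFC.sqrt b :=
      (ContinuousLinearMap.isSelfAdjoint_iff').1 (CFC.sqrt_nonneg b).isSelfAdjoint
    have hm : CFC.sqrt b (CFC.sqrt b (P.one hBf.toFinset)) = 0 := by
      rw [← h1]
      exact congrArg (fun T : L →L[ℂ] L => T (P.one hBf.toFinset)) (CFC.sqrt_mul_sqrt_self b hb0)
    rw [← inner_self_eq_zero (𝕜 := ℂ), ← ContinuousLinearMap.adjoint_inner_right, hsa, hm,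
      inner_zero_right]
  filter_upwards [P.eventually_q_one hBf] with S hS
  rw [(hb.sqrt hr hs ht).apply_eq (T := B), hS, h2, map_zero]
  rintro j rfl k hjk
  exact hjk

variable [Countable I]

/-- `x† x` as a sum of squares of self-adjoint operators in blocks; the number of squares only
depends on the support of `x`. -/
theorem exists_block_squares (hI : IsUniformlyLocallyFinite I) {K : Set (I × I)}
    (hK : CoarseSpace.IsControlled K) (P : BlockSpace I L) (Q : BlockSpace I M) :
    ∃ n : ℕ, ∀ x : L →L[ℂ] M, BlockSupp P Q x K → ∃ y : Fin n → L →L[ℂ] L,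
      (∀ k, IsSelfAdjoint (y k)) ∧ ∑ k, y k * y k = x† ∘L x ∧ (∀ k, ‖y k‖ ≤ ‖x‖) ∧
      (KillsOne P Q x → ∀ k, KillsOne P P (y k)) ∧
      ∀ k, ∃ r : Setoid I, {p : I × I | r p.1 p.2} ⊆ spread K ∧
        BlockSupp P P (y k) {p | r p.1 p.2} := by
  -- Rows that share a column get different colours, so within one colour each column meets at most
  -- one row of `K`.
  obtain ⟨n, hn⟩ := hI _ (CoarseSpace.comp hK (CoarseSpace.inverse hK))
  obtain ⟨χ, hχ⟩ := exists_coloring (fun i i' : I => ∃ j, (i, j) ∈ K ∧ (i', j) ∈ K)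
    (fun i i' ⟨j, h, h'⟩ => ⟨j, h', h⟩) n hn
  refine ⟨n + 1, fun x hx => ?_⟩
  let r : Fin (n + 1) → Setoid I := fun k =>
    { r := fun j j' => j = j' ∨ ∃ i, χ i = k ∧ (i, j) ∈ K ∧ (i, j') ∈ K
      iseqv :=
        { refl := fun j => Or.inl rfl
          symm := by
            rintro j j' (rfl | ⟨i, hi, h, h'⟩)
            · exact Or.inl rfl
            · exact Or.inr ⟨i, hi, h', h⟩
          -- The row `i` is determined by any column it meets together with its colour `k`; this
          -- makes the relation transitive.
          trans := by
            rintro a b c (rfl | ⟨i, hi, h1, h2⟩) (rfl | ⟨i', hi', h3, h4⟩)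
            · exact Or.inl rfl
            · exact Or.inr ⟨i', hi', h3, h4⟩
            · exact Or.inr ⟨i, hi, h1, h2⟩
            · obtain rfl := hχ i i' ⟨b, h2, h3⟩ (hi.trans hi'.symm)
              exact Or.inr ⟨i, hi, h1, h4⟩ } }
  have hrK : ∀ k, {p : I × I | r k p.1 p.2} ⊆ spread K := by
    rintro k ⟨j, j'⟩ (h | ⟨i, -, h, h'⟩)
    · exact Or.inr h
    · exact Or.inl ⟨i, h, h'⟩
  -- The rows of colour `k`. The operator `z k† z k` is supported on the equivalence relation `r k`,
  -- hence so is its square root.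
  let z : Fin (n + 1) → L →L[ℂ] M := fun k => Q.q {i | χ i = k} ∘L x
  have hzx : ∀ k, ‖z k‖ ≤ ‖x‖ := fun k =>
    (ContinuousLinearMap.opNorm_comp_le _ _).trans
      (mul_le_of_le_one_left (norm_nonneg _) (Q.norm_q_le _))
  have hz : ∀ k, BlockSupp P Q (z k) {p ∈ K | χ p.1 = k} := by
    intro k
    have h := hx.q_conj {i | χ i = k} univ
    rw [P.q_univ] at h
    exact h.mono fun p hp => ⟨hp.1, hp.2.1⟩
  let b : Fin (n + 1) → L →L[ℂ] L := fun k => (z k)† ∘L z k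
  have hb0 : ∀ k, 0 ≤ b k := fun k => nonneg_adjoint_comp_self _
  have hb : ∀ k, BlockSupp P P (b k) {p | r k p.1 p.2} := fun k =>
    ((hz k).adjoint.comp (hz k)).mono (by
      rintro ⟨j, j'⟩ ⟨i, hi, hi'⟩
      exact Or.inr ⟨i, hi.2, hi.1, hi'.1⟩)
  refine ⟨fun k => CFC.sqrt (b k), fun k => (CFC.sqrt_nonneg _).isSelfAdjoint, ?_, fun k => ?_,
    fun hk k => ?_, fun k => ⟨r k, hrK k, ?_⟩⟩
  · have h1 : ∀ k, CFC.sqrt (b k) * CFC.sqrt (b k) = x† ∘L Q.q {i | χ i = k} ∘L x := by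
      intro k
      rw [CFC.sqrt_mul_sqrt_self _ (hb0 k)]
      refine ContinuousLinearMap.ext fun ξ => ?_
      simp only [b, z, ContinuousLinearMap.adjoint_comp, ContinuousLinearMap.comp_apply,
        Q.adjoint_q, Q.q_apply_q, inter_self]
    rw [Finset.sum_congr rfl fun k _ => h1 k]
    refine ContinuousLinearMap.ext fun ξ => ?_
    have h2 := congrArg (fun T : M →L[ℂ] M => T (x ξ)) (Q.sum_q_fiber χ)
    simp only [sum_apply, one_apply_eq_self] at h2
    simp only [sum_apply, ContinuousLinearMap.comp_apply]
    rw [← map_sum, h2]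
  · have hsa : IsSelfAdjoint (CFC.sqrt (b k)) := (CFC.sqrt_nonneg _).isSelfAdjoint
    have h1 : ‖CFC.sqrt (b k)‖ * ‖CFC.sqrt (b k)‖ = ‖z k‖ * ‖z k‖ := by
      rw [← CStarRing.norm_self_mul_star (x := CFC.sqrt (b k)), hsa.star_eq,
        CFC.sqrt_mul_sqrt_self _ (hb0 k)]
      exact ContinuousLinearMap.norm_adjoint_comp_self _
    exact ((mul_self_inj (norm_nonneg _) (norm_nonneg _)).1 h1).trans_le (hzx k)
  · have hzc : ControlledOp P Q (z k) := ⟨_, CoarseSpace.subset hK fun p hp => hp.1, hz k⟩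
    have h1 : KillsOne P P (b k) :=
      (hk.controlled_comp hI (controlledOp_q _)).controlled_comp hI hzc.adjoint
    exact h1.sqrt hI (hb0 k) (hb k) (CoarseSpace.subset (isControlled_spread hK) (hrK k))
      (r k).refl (fun _ _ => (r k).symm) fun _ _ _ => (r k).trans
  · exact (hb k).sqrt (r k).refl (fun _ _ => (r k).symm) fun _ _ _ => (r k).trans

/-- A controlled operator restricted to the classes of a suitable finite partition of `I` has a
block diagonal absolute value. -/
lemma ControlledOp.exists_diagonal_pieces (hI : IsUniformlyLocallyFinite I) {y : L →L[ℂ] M}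
    (hy : ControlledOp P Q y) : ∃ (n : ℕ) (χ : I → Fin n), ∀ k,
      BlockSupp P P ((y ∘L P.q {i | χ i = k})† ∘L (y ∘L P.q {i | χ i = k}))
        {p | p.1 = p.2} := by
  obtain ⟨K, hK, hy⟩ := hy
  -- Here columns are coloured: two distinct columns of one colour share no row, so the off-diagonal
  -- blocks of the product vanish.
  obtain ⟨n, hn⟩ := hI _ (CoarseSpace.comp (CoarseSpace.inverse hK) hK)
  obtain ⟨χ, hχ⟩ := exists_coloring (fun j j' : I => ∃ i, (i, j) ∈ K ∧ (i, j') ∈ K)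
    (fun i i' ⟨j, h, h'⟩ => ⟨j, h', h⟩) n hn
  refine ⟨n + 1, χ, fun k => ?_⟩
  have h := hy.q_conj univ {i | χ i = k}
  rw [Q.q_univ] at h
  refine (h.adjoint.comp h).mono ?_
  rintro ⟨j, j'⟩ ⟨i, ⟨h1, -, h2⟩, ⟨h3, -, h4⟩⟩
  exact hχ j j' ⟨i, h1, h3⟩ (h2.trans h4.symm)

end Decomposition

/-! ### The induced representation -/

noncomputable section Induction

variable {I : Type*} [CoarseSpace I] {L M N N' H : Type*}
  [NormedAddCommGroup L] [InnerProductSpace ℂ L] [CompleteSpace L]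
  [NormedAddCommGroup M] [InnerProductSpace ℂ M] [CompleteSpace M]
  [NormedAddCommGroup N] [InnerProductSpace ℂ N] [CompleteSpace N]
  [NormedAddCommGroup N'] [InnerProductSpace ℂ N'] [CompleteSpace N']
  [NormedAddCommGroup H] [InnerProductSpace ℂ H] [CompleteSpace H]

/-- The space of operators with controlled support between two block spaces. -/
def controlledOps (P : BlockSpace I L) (Q : BlockSpace I M) : Submodule ℂ (L →L[ℂ] M) where
  carrier := {x | ControlledOp P Q x}
  add_mem' := fun hx hy => hx.add hy
  zero_mem' := controlledOp_zero
  smul_mem' := fun c _ hx => hx.smul c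

/-- A representation of the algebra of controlled operators of a block space, with a vector. -/
structure PointedRep (I M H : Type*) [CoarseSpace I]
    [NormedAddCommGroup M] [InnerProductSpace ℂ M] [CompleteSpace M]
    [NormedAddCommGroup H] [InnerProductSpace ℂ H] [CompleteSpace H] where
  space : BlockSpace I M
  ulf : IsUniformlyLocallyFinite I
  alg : StarSubalgebra ℂ (M →L[ℂ] M)
  mem_alg : ∀ T, T ∈ alg ↔ ControlledOp space space T
  rep : alg →⋆ₐ[ℂ] (H →L[ℂ] H)
  vec : H

namespace PointedRep

variable (D : PointedRep I M H)

/-- The operators from the block space of `D` to `R` with controlled support, with the inner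
product `⟨x, y⟩ = ⟨v, ρ(x† y) v⟩`. -/
def Pre (R : BlockSpace I N) : Type _ := controlledOps D.space R

variable {R : BlockSpace I N} {R' : BlockSpace I N'} {P : BlockSpace I L}

instance : AddCommGroup (D.Pre R) := inferInstanceAs (AddCommGroup (controlledOps D.space R))
instance : Module ℂ (D.Pre R) := inferInstanceAs (Module ℂ (controlledOps D.space R))

variable {D} in
/-- The operator underlying an element of `D.Pre R`. -/
def Pre.op (x : D.Pre R) : M →L[ℂ] N := Subtype.val (p := fun y => y ∈ controlledOps D.space R) x

variable {D} in
lemma Pre.controlled (x : D.Pre R) : ControlledOp D.space R x.op :=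
  Subtype.property (p := fun y => y ∈ controlledOps D.space R) x

/-- A controlled operator as an element of `D.Pre R`. -/
def ofOp (x : M →L[ℂ] N) (hx : ControlledOp D.space R x) : D.Pre R :=
  (⟨x, hx⟩ : controlledOps D.space R)

@[simp] lemma op_ofOp (x : M →L[ℂ] N) (hx : ControlledOp D.space R x) :
    (D.ofOp x hx).op = x := rfl

@[ext] lemma Pre.ext {x y : D.Pre R} (h : x.op = y.op) : x = y := Subtype.ext h

@[simp] lemma op_add (x y : D.Pre R) : (x + y).op = x.op + y.op := rfl

@[simp] lemma op_smul (c : ℂ) (x : D.Pre R) : (c • x).op = c • x.op := rfl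

/-- The action on the distinguished vector, extended by zero to all operators. -/
def act (T : M →L[ℂ] M) : H := by
  classical exact if h : T ∈ D.alg then D.rep ⟨T, h⟩ D.vec else 0

variable {D}

lemma act_mem {T : M →L[ℂ] M} (h : T ∈ D.alg) : D.act T = D.rep ⟨T, h⟩ D.vec := dif_pos h

lemma act_coe (T : D.alg) : D.act T = D.rep T D.vec := act_mem T.2

lemma act_add {S T : M →L[ℂ] M} (hS : ControlledOp D.space D.space S)
    (hT : ControlledOp D.space D.space T) : D.act (S + T) = D.act S + D.act T := by
  rw [← D.mem_alg] at hS hT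
  rw [act_mem hS, act_mem hT, act_mem (add_mem hS hT), ← add_apply, ← map_add]
  rfl

lemma act_smul (c : ℂ) {S : M →L[ℂ] M} (hS : ControlledOp D.space D.space S) :
    D.act (c • S) = c • D.act S := by
  rw [← D.mem_alg] at hS
  rw [act_mem hS, act_mem (SMulMemClass.smul_mem c hS), ← smul_apply, ← map_smul]
  rfl

lemma act_sum {ι : Type*} (s : Finset ι) (T : ι → M →L[ℂ] M)
    (hT : ∀ i, ControlledOp D.space D.space (T i)) :
    D.act (∑ i ∈ s, T i) = ∑ i ∈ s, D.act (T i) := by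
  have h : ∀ i, T i ∈ D.alg := fun i => (D.mem_alg _).2 (hT i)
  have h1 : (∑ i ∈ s, T i) = ((∑ i ∈ s, (⟨T i, h i⟩ : D.alg) : D.alg) : M →L[ℂ] M) := by
    simp
  rw [h1, act_coe, map_sum, sum_apply]
  exact Finset.sum_congr rfl fun i _ => (act_mem (h i)).symm

lemma rep_act (S : D.alg) {T : M →L[ℂ] M} (hT : ControlledOp D.space D.space T) :
    D.rep S (D.act T) = D.act (S ∘L T) := by
  rw [← D.mem_alg] at hT
  change _ = D.act (↑S * T)
  rw [act_mem hT, act_mem (mul_mem S.2 hT), ← mul_apply_eq_comp, ← map_mul]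
  rfl

lemma inner_act_act {S T : M →L[ℂ] M} (hS : ControlledOp D.space D.space S)
    (hT : ControlledOp D.space D.space T) :
    inner ℂ (D.act S) (D.act T) = inner ℂ D.vec (D.act (S† ∘L T)) := by
  have hS' := (D.mem_alg _).2 hS
  have h := rep_act (D := D) (star ⟨S, hS'⟩) hT
  rw [map_star] at h
  change _ = D.act (S† ∘L T) at h
  rw [← h, ContinuousLinearMap.star_eq_adjoint, ContinuousLinearMap.adjoint_inner_right,
    act_mem hS']

lemma inner_vec_act_adjoint {S : M →L[ℂ] M} (hS : ControlledOp D.space D.space S) :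
    inner ℂ D.vec (D.act (S†)) = star (inner ℂ D.vec (D.act S)) := by
  have hS' := (D.mem_alg _).2 hS
  have h : D.act (S†) = star (D.rep ⟨S, hS'⟩) D.vec := by
    rw [← map_star, ← act_coe]; rfl
  rw [h, ContinuousLinearMap.star_eq_adjoint, ContinuousLinearMap.adjoint_inner_right, act_mem hS']
  exact (inner_conj_symm _ _).symm

lemma re_inner_vec_act_sum_squares {n : ℕ} {y : Fin n → M →L[ℂ] M} (hsa : ∀ k, IsSelfAdjoint (y k))
    (hy : ∀ k, ControlledOp D.space D.space (y k)) :
    RCLike.re (inner ℂ D.vec (D.act (∑ k, y k * y k))) = ∑ k, ‖D.act (y k)‖ ^ 2 := by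
  rw [act_sum _ (fun k => y k * y k) fun k => (hy k).comp (hy k), inner_sum, map_sum]
  refine Finset.sum_congr rfl fun k _ => ?_
  have h := inner_act_act (hy k) (hy k)
  rw [(ContinuousLinearMap.isSelfAdjoint_iff').1 (hsa k)] at h
  change RCLike.re (inner ℂ D.vec (D.act (y k ∘L y k))) = _
  rw [← h, inner_self_eq_norm_sq]

variable (D) in
lemma controlledOp_adjoint_comp (x y : D.Pre R) :
    ControlledOp D.space D.space (x.op† ∘L y.op) := x.controlled.adjoint.comp y.controlled

variable [Countable I]

/-- The operator `x` runs between different spaces, so `x† ∘L x` is not visibly `S† S` with `S` in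
the algebra. The decomposition into squares supplies such factors, and each contributes
`‖ρ(y_k)v‖²`. -/
lemma re_inner_vec_act_nonneg {x : M →L[ℂ] N} (hx : ControlledOp D.space R x) :
    0 ≤ RCLike.re (inner ℂ D.vec (D.act (x† ∘L x))) := by
  obtain ⟨K, hK, hxK⟩ := hx
  obtain ⟨n, hn⟩ := exists_block_squares D.ulf hK D.space R
  obtain ⟨y, hsa, hy, -, -, hr⟩ := hn x hxK
  have hyc : ∀ k, ControlledOp D.space D.space (y k) := fun k => by
    obtain ⟨r, hr1, hr2⟩ := hr k
    exact ⟨_, CoarseSpace.subset (isControlled_spread hK) hr1, hr2⟩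
  rw [← hy, re_inner_vec_act_sum_squares hsa hyc]
  exact Finset.sum_nonneg fun k _ => sq_nonneg _

variable (D)

/-- The positive semidefinite inner product of `D.Pre R`. -/
abbrev preCore (R : BlockSpace I N) : PreInnerProductSpace.Core ℂ (D.Pre R) where
  inner x y := inner ℂ D.vec (D.act (x.op† ∘L y.op))
  conj_inner_symm x y := by
    have h := inner_vec_act_adjoint (D.controlledOp_adjoint_comp y x)
    rw [ContinuousLinearMap.adjoint_comp, ContinuousLinearMap.adjoint_adjoint] at h
    exact h.symm
  re_inner_nonneg x := re_inner_vec_act_nonneg x.controlled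
  add_left x y z := by
    rw [← inner_add_right, ← act_add (D.controlledOp_adjoint_comp x z)
      (D.controlledOp_adjoint_comp y z), op_add, map_add, ContinuousLinearMap.add_comp]
  smul_left x y c := by
    rw [op_smul, map_smulₛₗ, ContinuousLinearMap.smul_comp,
      act_smul _ (D.controlledOp_adjoint_comp x y), inner_smul_right]

instance : SeminormedAddCommGroup (D.Pre R) :=
  InnerProductSpace.Core.toSeminormedAddCommGroup (c := D.preCore R)

instance : InnerProductSpace ℂ (D.Pre R) := InnerProductSpace.ofCore (D.preCore R)

lemma inner_def (x y : D.Pre R) :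
    inner ℂ x y = inner ℂ D.vec (D.act (x.op† ∘L y.op)) := rfl

lemma norm_sq_def (x : D.Pre R) :
    ‖x‖ ^ 2 = RCLike.re (inner ℂ D.vec (D.act (x.op† ∘L x.op))) := by
  rw [← inner_def, inner_self_eq_norm_sq]

variable {D}

/-- Composition with a controlled operator as a linear map. -/
def compₗ (y : N →L[ℂ] N') (hy : ControlledOp R R' y) : D.Pre R →ₗ[ℂ] D.Pre R' where
  toFun x := D.ofOp (y ∘L x.op) (hy.comp x.controlled)
  map_add' x z := by ext1; exact ContinuousLinearMap.comp_add _ _ _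
  map_smul' c x := by ext1; exact ContinuousLinearMap.comp_smul _ _ _

/-- With `s† s = ‖y‖² - y† y` one has `‖s x‖² + ‖y x‖² = ‖y‖² ‖x‖²` in the new norm. Since `s` is
block diagonal, it is controlled and `s x` again belongs to the space. -/
lemma norm_compₗ_le_of_diagonal {y : N →L[ℂ] N'} (hy : ControlledOp R R' y)
    (hd : BlockSupp R R (y† ∘L y) {p | p.1 = p.2}) (x : D.Pre R) :
    ‖compₗ y hy x‖ ≤ ‖y‖ * ‖x‖ := by
  obtain ⟨s, hs, hsy⟩ := exists_diagonal_complement hd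
  have hsc : ControlledOp R R s := ⟨_, CoarseSpace.diagonal, hs⟩
  have h1 : ‖compₗ s hsc x‖ ^ 2 + ‖compₗ y hy x‖ ^ 2 = ‖y‖ ^ 2 * ‖x‖ ^ 2 := by
    rw [norm_sq_def, norm_sq_def, norm_sq_def, ← map_add, ← inner_add_right, ← act_add
      (D.controlledOp_adjoint_comp _ _) (D.controlledOp_adjoint_comp _ _)]
    have h2 : (compₗ s hsc x).op† ∘L (compₗ s hsc x).op + (compₗ y hy x).op† ∘L (compₗ y hy x).op
        = ((‖y‖ ^ 2 : ℝ) : ℂ) • (x.op† ∘L x.op) := by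
      have h3 : x.op† ∘L (s† ∘L s + y† ∘L y) ∘L x.op
          = x.op† ∘L (((‖y‖ ^ 2 : ℝ) : ℂ) • (1 : N →L[ℂ] N)) ∘L x.op := by rw [hsy]
      refine ContinuousLinearMap.ext fun ξ => ?_
      have h4 := congrArg (fun T : M →L[ℂ] M => T ξ) h3
      simp only [compₗ, LinearMap.coe_mk, AddHom.coe_mk, op_ofOp, ContinuousLinearMap.adjoint_comp,
        add_apply, smul_apply, ContinuousLinearMap.comp_apply, map_add, map_smul,
        one_apply_eq_self] at h4 ⊢
      exact h4
    rw [h2, act_smul _ (D.controlledOp_adjoint_comp _ _), inner_smul_right,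
      RCLike.re_to_complex, Complex.re_ofReal_mul]
    rfl
  refine abs_le_of_sq_le_sq' ?_ (by positivity) |>.2
  rw [mul_pow, ← h1]
  exact le_add_of_nonneg_left (sq_nonneg _)

/-- The colour pieces `y q_k` satisfy the diagonal hypothesis and there are finitely many of them,
so their bounds add up. -/
lemma exists_bound_compₗ {y : N →L[ℂ] N'} (hy : ControlledOp R R' y) :
    ∃ C, ∀ x : D.Pre R, ‖compₗ y hy x‖ ≤ C * ‖x‖ := by
  obtain ⟨n, χ, hχ⟩ := hy.exists_diagonal_pieces D.ulf
  have hc : ∀ k, ControlledOp R R' (y ∘L R.q {i | χ i = k}) := fun k => hy.comp (controlledOp_q _)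
  refine ⟨∑ k, ‖y ∘L R.q {i | χ i = k}‖, fun x => ?_⟩
  have h : compₗ y hy x = ∑ k, compₗ _ (hc k) x := by
    have h1 : ∀ s : Finset (Fin n), (∑ k ∈ s, compₗ _ (hc k) x).op
        = y ∘L (∑ k ∈ s, R.q {i | χ i = k}) ∘L x.op := by
      intro s
      induction s using Finset.cons_induction with
      | empty => simp only [Finset.sum_empty, ContinuousLinearMap.zero_comp,
          ContinuousLinearMap.comp_zero]; rfl
      | cons a s ha ih =>
        rw [Finset.sum_cons, op_add, ih, Finset.sum_cons, ContinuousLinearMap.add_comp,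
          ContinuousLinearMap.comp_add]
        rfl
    ext1
    rw [h1, R.sum_q_fiber]
    rfl
  rw [h, Finset.sum_mul]
  exact (norm_sum_le _ _).trans
    (Finset.sum_le_sum fun k _ => norm_compₗ_le_of_diagonal (hc k) (hχ k) x)

/-- Composition with a controlled operator as a bounded operator. -/
def compL (y : N →L[ℂ] N') (hy : ControlledOp R R' y) : D.Pre R →L[ℂ] D.Pre R' :=
  (compₗ y hy).mkContinuousOfExistsBound (exists_bound_compₗ hy)

@[simp] lemma op_compL (y : N →L[ℂ] N') (hy : ControlledOp R R' y) (x : D.Pre R) :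
    (compL y hy x).op = y ∘L x.op := rfl

lemma inner_compL_left (y : N →L[ℂ] N') (hy : ControlledOp R R' y) (x : D.Pre R) (z : D.Pre R') :
    inner ℂ (compL y hy x) z = inner ℂ x (compL (y†) hy.adjoint z) := by
  rw [inner_def, inner_def, op_compL, op_compL, ContinuousLinearMap.adjoint_comp,
    ContinuousLinearMap.comp_assoc]

variable (D)

/-- The Hilbert space completion of `D.Pre R`. -/
abbrev Hil (R : BlockSpace I N) := UniformSpace.Completion (D.Pre R)

variable {D}

/-- The extension of `compL` to the completions. -/
def compH (y : N →L[ℂ] N') (hy : ControlledOp R R' y) : D.Hil R →L[ℂ] D.Hil R' :=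
  (compL y hy).completion

@[simp] lemma compH_coe (y : N →L[ℂ] N') (hy : ControlledOp R R' y) (x : D.Pre R) :
    compH y hy (x : D.Hil R) = (compL y hy x : D.Pre R') := by simp [compH]

lemma norm_compH_le_of_diagonal {y : N →L[ℂ] N'} (hy : ControlledOp R R' y)
    (hd : BlockSupp R R (y† ∘L y) {p | p.1 = p.2}) (z : D.Hil R) :
    ‖compH y hy z‖ ≤ ‖y‖ * ‖z‖ := by
  induction z using UniformSpace.Completion.induction_on with
  | hp => exact isClosed_le (by fun_prop) (by fun_prop)
  | ih x =>
    rw [compH_coe, UniformSpace.Completion.norm_coe, UniformSpace.Completion.norm_coe]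
    exact norm_compₗ_le_of_diagonal hy hd x

lemma inner_compH_left (y : N →L[ℂ] N') (hy : ControlledOp R R' y) (x : D.Hil R) (z : D.Hil R') :
    inner ℂ (compH y hy x) z = inner ℂ x (compH (y†) hy.adjoint z) := by
  induction x, z using UniformSpace.Completion.induction_on₂ with
  | hp => exact isClosed_eq (by fun_prop) (by fun_prop)
  | ih x z =>
    rw [compH_coe, compH_coe, UniformSpace.Completion.inner_coe, UniformSpace.Completion.inner_coe,
      inner_compL_left]

lemma compH_compH {R'' : BlockSpace I L} (w : N' →L[ℂ] L) (hw : ControlledOp R' R'' w)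
    (y : N →L[ℂ] N') (hy : ControlledOp R R' y) (z : D.Hil R) :
    compH w hw (compH y hy z) = compH (w ∘L y) (hw.comp hy) z := by
  induction z using UniformSpace.Completion.induction_on with
  | hp => exact isClosed_eq (by fun_prop) (by fun_prop)
  | ih x =>
    rw [compH_coe, compH_coe, compH_coe]
    rfl

variable (D) in
/-- The evaluation `x ↦ ρ(x) v` as an isometric map. -/
def evalₗ : D.Pre D.space →ₗ[ℂ] H where
  toFun x := D.act x.op
  map_add' x y := act_add x.controlled y.controlled
  map_smul' c x := act_smul c x.controlled

lemma norm_evalₗ (x : D.Pre D.space) : ‖D.evalₗ x‖ = ‖x‖ := by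
  have h : ‖D.evalₗ x‖ ^ 2 = ‖x‖ ^ 2 := by
    rw [norm_sq_def, ← inner_act_act x.controlled x.controlled, inner_self_eq_norm_sq]
    rfl
  rwa [sq_eq_sq₀ (norm_nonneg _) (norm_nonneg _)] at h

variable (D) in
/-- The evaluation on the completion. -/
def evalH : D.Hil D.space →L[ℂ] H :=
  (D.evalₗ.mkContinuous 1 fun x => by rw [norm_evalₗ, one_mul]).fromCompletion

@[simp] lemma evalH_coe (x : D.Pre D.space) : D.evalH (x : D.Hil D.space) = D.act x.op := by
  simp [evalH]; rfl

lemma norm_evalH (z : D.Hil D.space) : ‖D.evalH z‖ = ‖z‖ := by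
  induction z using UniformSpace.Completion.induction_on with
  | hp => exact isClosed_eq (by fun_prop) (by fun_prop)
  | ih x =>
    rw [evalH_coe, UniformSpace.Completion.norm_coe]
    exact norm_evalₗ x

lemma rep_evalH (T : D.alg) (z : D.Hil D.space) :
    D.rep T (D.evalH z) = D.evalH (compH T ((D.mem_alg _).1 T.2) z) := by
  induction z using UniformSpace.Completion.induction_on with
  | hp => exact isClosed_eq (by fun_prop) (by fun_prop)
  | ih x =>
    rw [compH_coe, evalH_coe, evalH_coe, rep_act _ x.controlled]
    rfl

/-- The induced representation. -/
def inducedRep (𝒜 : StarSubalgebra ℂ (L →L[ℂ] L)) (h𝒜 : ∀ T, T ∈ 𝒜 ↔ ControlledOp P P T) :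
    𝒜 →⋆ₐ[ℂ] (D.Hil P →L[ℂ] D.Hil P) where
  toFun a := compH a ((h𝒜 _).1 a.2)
  map_one' := by
    ext z
    induction z using UniformSpace.Completion.induction_on with
    | hp => exact isClosed_eq (by fun_prop) (by fun_prop)
    | ih x => rw [compH_coe]; rfl
  map_mul' a b := by
    ext z
    exact (compH_compH _ _ _ _ z).symm
  map_zero' := by
    ext z
    induction z using UniformSpace.Completion.induction_on with
    | hp => exact isClosed_eq (by fun_prop) (by fun_prop)
    | ih x =>
      rw [compH_coe, zero_apply, ← UniformSpace.Completion.coe_zero]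
      congr 1
  map_add' a b := by
    ext z
    induction z using UniformSpace.Completion.induction_on with
    | hp => exact isClosed_eq (by fun_prop) (by fun_prop)
    | ih x =>
      rw [add_apply, compH_coe, compH_coe, compH_coe, ← UniformSpace.Completion.coe_add]
      congr 1
  commutes' c := by
    ext z
    induction z using UniformSpace.Completion.induction_on with
    | hp => exact isClosed_eq (by fun_prop) (by fun_prop)
    | ih x =>
      rw [compH_coe, Algebra.algebraMap_eq_smul_one, Algebra.algebraMap_eq_smul_one, smul_apply, one_apply_eq_self,
        ← UniformSpace.Completion.coe_smul]
      congr 1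
  map_star' a := by
    rw [ContinuousLinearMap.star_eq_adjoint, ContinuousLinearMap.eq_adjoint_iff]
    intro x y
    have h := inner_compH_left (D := D) _ (((h𝒜 _).1 a.2).adjoint) x y
    simp only [ContinuousLinearMap.adjoint_adjoint] at h
    exact h

lemma inducedRep_apply (𝒜 : StarSubalgebra ℂ (L →L[ℂ] L))
    (h𝒜 : ∀ T, T ∈ 𝒜 ↔ ControlledOp P P T) (a : 𝒜) (z : D.Hil P) :
    D.inducedRep 𝒜 h𝒜 a z = compH a ((h𝒜 _).1 a.2) z := rfl

end PointedRep

end Induction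

/-! ### `L²(X, μ)` as a block space over a discretisation -/

noncomputable section MeasureBlocks

section Indicator

variable {X : Type u} {mX : MeasurableSpace X} {μ : Measure X}

lemma coeFn_mulOp (f : Lp ℂ ∞ μ) (ξ : L2 μ) : mulOp f ξ =ᵐ[μ] fun x => f x * ξ x :=
  (ContinuousLinearMap.mul ℂ ℂ).coeFn_holder f ξ

/-- The indicator function of a measurable set in `L^∞`. -/
def indTop {A : Set X} (hA : MeasurableSet A) : Lp ℂ ∞ μ :=
  ((memLp_top_const (1 : ℂ)).indicator hA).toLp _

lemma coeFn_indTop {A : Set X} (hA : MeasurableSet A) :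
    (indTop hA : Lp ℂ ∞ μ) =ᵐ[μ] A.indicator fun _ => 1 := MemLp.coeFn_toLp _

lemma coeFn_mulOp_indTop {A : Set X} (hA : MeasurableSet A) (ξ : L2 μ) :
    mulOp (indTop hA) ξ =ᵐ[μ] A.indicator ξ := by
  filter_upwards [coeFn_mulOp (indTop hA) ξ, coeFn_indTop (μ := μ) hA] with x h1 h2
  rw [h1, h2]
  by_cases hx : x ∈ A <;> simp [hx]

lemma enorm_sq_eq_lintegral (ξ : L2 μ) : ‖ξ‖ₑ ^ 2 = ∫⁻ x, ‖ξ x‖ₑ ^ 2 ∂μ := by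
  rw [Lp.enorm_def]
  have h := eLpNorm_nnreal_pow_eq_lintegral (f := ξ) (μ := μ) (p := 2) two_ne_zero
  simpa using h

lemma mulOp_zero : mulOp (0 : Lp ℂ ∞ μ) = 0 :=
  map_zero ((ContinuousLinearMap.mul ℂ ℂ).holderL μ ∞ 2 2)

end Indicator

variable {X : Type u} [CoarseSpace X] {mX : MeasurableSpace X} {μ : Measure X}
  {I : Type*} [CoarseSpace I]

/-- A discretisation of a coarse space with a uniformly bounded measure: a measurable map to a
discrete coarse space that determines the coarse structure, with fibres whose measures are bounded
away from zero. -/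
structure IsBlockMap (μ : Measure X) (κ : X → I) : Prop where
  measurable : ∀ S : Set I, MeasurableSet (κ ⁻¹' S)
  controlled_iff : ∀ E : Set (X × X),
    CoarseSpace.IsControlled E ↔ CoarseSpace.IsControlled (Prod.map κ κ '' E)
  lower : ∃ ε : ℝ≥0, 0 < ε ∧ ∀ i, (ε : ℝ≥0∞) ≤ μ (κ ⁻¹' {i})
  bounded : IsUniformlyBounded μ

namespace IsBlockMap

variable {κ : X → I} (h : IsBlockMap μ κ)
include h

lemma controlled_preimage {E : Set (I × I)} (hE : CoarseSpace.IsControlled E) :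
    CoarseSpace.IsControlled (Prod.map κ κ ⁻¹' E) :=
  (h.controlled_iff _).2 (CoarseSpace.subset hE (image_preimage_subset _ _))

/-- Two points over the same section of `E` are related by the preimage of `E⁻¹ ∘ E`, so uniform
boundedness applies. -/
lemma exists_measure_section_le {E : Set (I × I)} (hE : CoarseSpace.IsControlled E) :
    ∃ C : ℝ≥0, ∀ i, μ (κ ⁻¹' {j | (i, j) ∈ E}) ≤ C := by
  obtain ⟨C, hC⟩ := h.bounded _ (h.controlled_preimage
    (CoarseSpace.comp (CoarseSpace.inverse hE) hE))
  refine ⟨C, fun i => hC _ (h.measurable _) ?_⟩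
  rintro ⟨x, y⟩ ⟨hx, hy⟩
  exact ⟨i, hx, hy⟩

lemma exists_measure_fiber_le : ∃ C : ℝ≥0, ∀ i, μ (κ ⁻¹' {i}) ≤ C := by
  obtain ⟨C, hC⟩ := h.exists_measure_section_le CoarseSpace.diagonal
  refine ⟨C, fun i => ?_⟩
  convert hC i using 3
  ext j; simp [eq_comm]

lemma measure_fiber_lt_top (i : I) : μ (κ ⁻¹' {i}) < ∞ := by
  obtain ⟨C, hC⟩ := h.exists_measure_fiber_le
  exact (hC i).trans_lt ENNReal.coe_lt_top

lemma measure_fiber_ne_zero (i : I) : μ (κ ⁻¹' {i}) ≠ 0 := by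
  obtain ⟨ε, hε, hμ⟩ := h.lower
  exact ((ENNReal.coe_pos.2 hε).trans_le (hμ i)).ne'

lemma measure_preimage_finset (S : Finset I) : μ (κ ⁻¹' S) = ∑ i ∈ S, μ (κ ⁻¹' {i}) := by
  have h1 : κ ⁻¹' S = ⋃ i ∈ S, κ ⁻¹' {i} := by ext x; simp
  rw [h1, measure_biUnion_finset _ fun i _ => h.measurable _]
  intro i _ j _ hij
  exact Disjoint.preimage κ (by simpa using hij)

lemma measure_preimage_finset_ne_top (S : Finset I) : μ (κ ⁻¹' S) ≠ ∞ := by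
  rw [h.measure_preimage_finset]
  exact (ENNReal.sum_lt_top.2 fun i _ => h.measure_fiber_lt_top i).ne

/-- A volume count: the fibres over a section are disjoint, each of measure at least `ε`, with total
measure at most `C`. -/
lemma isUniformlyLocallyFinite : IsUniformlyLocallyFinite I := by
  intro E hE
  obtain ⟨C, hC⟩ := h.exists_measure_section_le hE
  obtain ⟨ε, hε, hμ⟩ := h.lower
  obtain ⟨k, hk⟩ := exists_nat_gt (C / ε)
  refine ⟨k, fun i => ?_⟩
  by_contra hcon
  push Not at hcon
  obtain ⟨t, htE, htk⟩ := exists_subset_encard_eq hcon.le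
  obtain ⟨t, rfl⟩ := (finite_of_encard_eq_coe htk).exists_finset_coe
  rw [encard_coe_eq_coe_finsetCard] at htk
  have htk' : t.card = k := by exact_mod_cast htk
  have h1 : (t.card : ℝ≥0∞) * ε ≤ C := by
    rw [← nsmul_eq_mul]
    refine (Finset.card_nsmul_le_sum t _ _ fun i _ => hμ i).trans ?_
    rw [← h.measure_preimage_finset]
    exact (measure_mono (preimage_mono htE)).trans (hC i)
  rw [htk'] at h1
  have h2 : (k : ℝ≥0) * ε ≤ C := by exact_mod_cast h1
  exact absurd h2 (not_le.2 ((div_lt_iff₀ hε).1 hk))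

lemma isBoundedSet_fiber (i : I) : IsBoundedSet (κ ⁻¹' {i}) :=
  CoarseSpace.subset (h.controlled_preimage CoarseSpace.diagonal) (by
    rintro ⟨x, y⟩ ⟨hx, hy⟩
    exact (show κ x = i from hx).trans (show κ y = i from hy).symm)

/-- `L²(X, μ)` as a block space over the discretisation. -/
def space : BlockSpace I (L2 μ) where
  q S := mulOp (indTop (h.measurable S))
  q_inter S T := by
    refine ContinuousLinearMap.ext fun ξ => Lp.ext ?_
    rw [mul_apply_eq_comp]
    filter_upwards [coeFn_mulOp_indTop (h.measurable S) (mulOp (indTop (h.measurable T)) ξ),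
      coeFn_mulOp_indTop (h.measurable T) ξ, coeFn_mulOp_indTop (h.measurable (S ∩ T)) ξ]
      with x h1 h2 h3
    rw [h1, h3]
    by_cases hS : κ x ∈ S <;> by_cases hT : κ x ∈ T <;> simp [indicator, hS, hT, h2]
  q_univ := by
    refine ContinuousLinearMap.ext fun ξ => Lp.ext ?_
    filter_upwards [coeFn_mulOp_indTop (h.measurable univ) ξ] with x h1
    rw [h1]; simp
  q_union S T hST := by
    refine ContinuousLinearMap.ext fun ξ => Lp.ext ?_
    rw [add_apply]
    filter_upwards [coeFn_mulOp_indTop (h.measurable S) ξ, coeFn_mulOp_indTop (h.measurable T) ξ,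
      coeFn_mulOp_indTop (h.measurable (S ∪ T)) ξ, Lp.coeFn_add (mulOp (indTop (h.measurable S)) ξ)
        (mulOp (indTop (h.measurable T)) ξ)] with x h1 h2 h3 h4
    rw [h4, h3, Pi.add_apply, h1, h2, preimage_union,
      indicator_union_of_disjoint (Disjoint.preimage κ hST)]
  q_star S := by
    rw [ContinuousLinearMap.isSelfAdjoint_iff_isSymmetric]
    intro ξ η
    rw [ContinuousLinearMap.coe_coe, L2.inner_def, L2.inner_def]
    apply integral_congr_ae
    filter_upwards [coeFn_mulOp_indTop (h.measurable S) ξ, coeFn_mulOp_indTop (h.measurable S) η]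
      with x h1 h2
    rw [h1, h2]
    by_cases hx : κ x ∈ S <;> simp [indicator, hx]
  one S := indicatorConstLp 2 (h.measurable S) (h.measure_preimage_finset_ne_top S) 1
  q_one S T U hU := by
    refine Lp.ext ?_
    filter_upwards [coeFn_mulOp_indTop (h.measurable S)
      (indicatorConstLp 2 (h.measurable T) (h.measure_preimage_finset_ne_top T) 1),
      indicatorConstLp_coeFn (p := 2) (hs := h.measurable T)
        (hμs := h.measure_preimage_finset_ne_top T) (c := (1 : ℂ)),
      indicatorConstLp_coeFn (p := 2) (hs := h.measurable U)
        (hμs := h.measure_preimage_finset_ne_top U) (c := (1 : ℂ))] with x h1 h2 h3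
    rw [h1, h3, hU]
    by_cases hS : κ x ∈ S <;> by_cases hT : κ x ∈ (T : Set I) <;> simp_all [indicator]

lemma coeFn_q (S : Set I) (ξ : L2 μ) : h.space.q S ξ =ᵐ[μ] (κ ⁻¹' S).indicator ξ :=
  coeFn_mulOp_indTop (h.measurable S) ξ

lemma coeFn_one (S : Finset I) : h.space.one S =ᵐ[μ] (κ ⁻¹' S).indicator fun _ => 1 :=
  indicatorConstLp_coeFn (hs := h.measurable S) (hμs := h.measure_preimage_finset_ne_top S)

lemma q_eq_zero_iff (S : Set I) (ξ : L2 μ) :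
    h.space.q S ξ = 0 ↔ ∀ᵐ x ∂μ, κ x ∈ S → ξ x = 0 := by
  constructor
  · intro h0
    have h1 : (h.space.q S ξ : X → ℂ) =ᵐ[μ] (0 : X → ℂ) := by rw [h0]; exact Lp.coeFn_zero ℂ 2 μ
    filter_upwards [h.coeFn_q S ξ, h1] with x hx hx0 hxS
    rw [hx0, indicator_of_mem (show x ∈ κ ⁻¹' S from hxS)] at hx
    exact hx.symm
  · intro h0
    refine Lp.ext ?_
    filter_upwards [h.coeFn_q S ξ, h0, Lp.coeFn_zero ℂ 2 μ] with x h1 h2 h3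
    rw [h1, h3]
    by_cases hx : κ x ∈ S <;> simp [indicator, hx, h2]

lemma q_eq_self_iff (S : Set I) (ξ : L2 μ) :
    h.space.q S ξ = ξ ↔ SupportedIn ξ (κ ⁻¹' S) := by
  have h1 := h.q_eq_zero_iff Sᶜ ξ
  have h2 := h.space.q_add_compl_apply S ξ
  rw [SupportedIn]
  refine Iff.trans ?_ h1
  constructor
  · intro h3
    rw [h3] at h2
    exact add_eq_left.1 h2
  · intro h3
    rwa [h3, add_zero] at h2

/-- The transposition reconciles two conventions: pairs in `BlockSupp` are (output, input), while
`E_U` puts the input first. -/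
lemma blockSupp_of_isSupportedOn {T : L2 μ →L[ℂ] L2 μ} {E : Set (X × X)}
    (hT : IsSupportedOn T E) :
    BlockSupp h.space h.space T {p | (p.2, p.1) ∈ Prod.map κ κ '' E} := by
  intro S S' hSS' ξ
  rw [q_eq_zero_iff]
  have h1 := (isSupportedOn_iff _ _ hT.1).1 hT _ (h.measurable S) (h.space.q S' ξ) ?_
  · filter_upwards [h1] with x hx hxS
    exact hx fun hc => hc hxS
  · filter_upwards [h.coeFn_q S' ξ] with x hx hxE
    rw [hx, indicator_of_notMem]
    intro hxS'
    have hxE' : x ∈ nbhdSet E (κ ⁻¹' S) := by simpa using hxE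
    obtain ⟨y, hy, hxy⟩ := mem_nbhdSet.1 hxE'
    exact hSS' (κ y) hy (κ x) hxS' ⟨(x, y), hxy, rfl⟩

lemma isSupportedOn_of_blockSupp {T : L2 μ →L[ℂ] L2 μ} {E : Set (I × I)}
    (hT : BlockSupp h.space h.space T E) :
    IsSupportedOn T {p : X × X | (κ p.2, κ p.1) ∈ E} := by
  have hE : ∀ U : Set X, nbhdSet {p : X × X | (κ p.2, κ p.1) ∈ E} U
      = κ ⁻¹' {j | ∃ i ∈ κ '' U, (i, j) ∈ E} := by
    intro U
    ext x
    simp [mem_nbhdSet]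
  have hm : IsMeasurableRel {p : X × X | (κ p.2, κ p.1) ∈ E} := fun U _ => by
    rw [hE]; exact h.measurable _
  rw [isSupportedOn_iff _ _ hm]
  intro U hU ζ hζ
  rw [hE, ← preimage_compl, ← h.q_eq_self_iff] at hζ
  have h1 := hT (κ '' U) {j | ∃ i ∈ κ '' U, (i, j) ∈ E}ᶜ (fun i hi j hj hij => hj ⟨i, hi, hij⟩) ζ
  rw [hζ, q_eq_zero_iff] at h1
  filter_upwards [h1] with x hx hxU
  exact hx ⟨x, by simpa using hxU, rfl⟩

lemma hasControlledSupport_iff (T : L2 μ →L[ℂ] L2 μ) :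
    HasControlledSupport T ↔ ControlledOp h.space h.space T := by
  constructor
  · rintro ⟨E, hE, hT⟩
    exact ⟨_, CoarseSpace.inverse ((h.controlled_iff E).1 hE), h.blockSupp_of_isSupportedOn hT⟩
  · rintro ⟨E, hE, hT⟩
    exact ⟨_, CoarseSpace.inverse (h.controlled_preimage hE), h.isSupportedOn_of_blockSupp hT⟩

lemma mem_controlledAlgebra (T : L2 μ →L[ℂ] L2 μ) :
    T ∈ controlledAlgebra μ ↔ ControlledOp h.space h.space T := by
  change HasControlledSupport T ∧ HasControlledSupport (star T) ↔ _
  rw [h.hasControlledSupport_iff, h.hasControlledSupport_iff]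
  exact ⟨fun h => h.1, fun h => ⟨h, h.adjoint⟩⟩

lemma mulOp_q (f : Lp ℂ ∞ μ) (S : Set I) (ξ : L2 μ) :
    mulOp f (h.space.q S ξ) = h.space.q S (mulOp f ξ) := by
  refine Lp.ext ?_
  filter_upwards [coeFn_mulOp f (h.space.q S ξ), h.coeFn_q S ξ, h.coeFn_q S (mulOp f ξ),
    coeFn_mulOp f ξ] with x h1 h2 h3 h4
  rw [h1, h2, h3]
  by_cases hx : κ x ∈ S <;> simp [indicator, hx, h4]

lemma blockSupp_mulOp (f : Lp ℂ ∞ μ) : BlockSupp h.space h.space (mulOp f) {p | p.1 = p.2} := by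
  intro S T hST ξ
  rw [h.mulOp_q, h.space.q_apply_q]
  have : S ∩ T = ∅ := by
    ext i
    simp only [mem_inter_iff, mem_empty_iff_false, iff_false]
    exact fun hi => hST i hi.1 i hi.2 rfl
  rw [this]; simp

lemma integral_star_mul_eq_inner (f : Lp ℂ ∞ μ) {ξ : L2 μ} {S : Finset I}
    (hξ : h.space.q S ξ = ξ) :
    ∫ x, star (ξ x) * f x ∂μ = inner ℂ ξ (mulOp f (h.space.one S)) := by
  rw [L2.inner_def]
  apply integral_congr_ae
  rw [q_eq_self_iff] at hξ
  filter_upwards [hξ, coeFn_mulOp f (h.space.one S), h.coeFn_one S] with x h1 h2 h3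
  rw [h2, h3]
  by_cases hx : x ∈ κ ⁻¹' S
  · simp [indicator_of_mem hx, mul_comm]
  · simp [h1 hx]

lemma integral_star_eq_inner {ξ : L2 μ} {S : Finset I} (hξ : h.space.q S ξ = ξ) :
    ∫ x, star (ξ x) ∂μ = inner ℂ ξ (h.space.one S) := by
  rw [L2.inner_def]
  apply integral_congr_ae
  rw [q_eq_self_iff] at hξ
  filter_upwards [hξ, h.coeFn_one S] with x h1 h3
  rw [h3]
  by_cases hx : x ∈ κ ⁻¹' S
  · simp [indicator_of_mem hx]
  · simp [h1 hx]

/-- If `ξ` lives over finitely many blocks, so does `T† ξ`. On both supports the constant function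
`1` may then be replaced by `one S` for large `S`. -/
lemma eventually_q_adjoint {T : L2 μ →L[ℂ] L2 μ} (hT : ControlledOp h.space h.space T)
    (S₀ : Finset I) : ∀ᶠ S : Finset I in atTop, ∀ ξ : L2 μ, h.space.q S₀ ξ = ξ →
      h.space.q S ξ = ξ ∧ h.space.q S ((T†) ξ) = (T†) ξ := by
  obtain ⟨E, hE, hTE⟩ := hT
  have hfin : {j | ∃ i ∈ S₀, (i, j) ∈ E}.Finite := by
    have : {j | ∃ i ∈ S₀, (i, j) ∈ E} = ⋃ i ∈ S₀, {j | (i, j) ∈ E} := by ext j; simp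
    rw [this]
    exact S₀.finite_toSet.biUnion fun i _ => h.isUniformlyLocallyFinite.finite hE i
  filter_upwards [eventually_ge_atTop S₀, eventually_ge_atTop hfin.toFinset] with S h1 h2 ξ hξ
  constructor
  · conv_lhs => rw [← hξ]
    rw [h.space.q_apply_q, inter_eq_right.2 (by simpa using h1), hξ]
  · have h3 := hTE.adjoint.apply_q (S := S) (T := S₀) (by
      intro j i hi hij
      exact h2 (by simpa using ⟨i, hi, hij⟩)) ξ
    rw [hξ] at h3
    exact h3.symm

/-- Testing against vectors supported in one fibre turns both integrals defining `Φ(T)` into inner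
products with `one S`. -/
lemma killsOne_of_isPhi {T : L2 μ →L[ℂ] L2 μ} (hT : ControlledOp h.space h.space T)
    {f : Lp ℂ ∞ μ} (hf : IsPhi T f) : KillsOne h.space h.space (T - mulOp f) := by
  intro i
  filter_upwards [h.eventually_q_adjoint hT {i}] with S hS
  refine ext_inner_left ℂ fun ξ => ?_
  obtain ⟨h1, h2⟩ := hS (h.space.q {i} ξ) (by rw [h.space.q_apply_q]; simp)
  have h3 := hf.2 (h.space.q {i} ξ) ⟨_, h.measurable {i}, h.isBoundedSet_fiber i, by
    rw [← h.q_eq_self_iff, h.space.q_apply_q, inter_self]⟩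
  rw [h.integral_star_mul_eq_inner f h1, h.integral_star_eq_inner h2,
    ContinuousLinearMap.adjoint_inner_left] at h3
  rw [← h.space.inner_q_left, inner_zero_right, sub_apply, inner_sub_right, h3, sub_self]

/-- Bounded measurable sets have finite measure, so `f` is locally `L²`. A bounded set meets only
finitely many fibres, since its image lies in one section of a controlled set. -/
lemma isPhi_of_killsOne {T : L2 μ →L[ℂ] L2 μ} (hT : ControlledOp h.space h.space T)
    {f : Lp ℂ ∞ μ} (hf : KillsOne h.space h.space (T - mulOp f)) : IsPhi T f := by
  refine ⟨⟨Lp.aestronglyMeasurable f, fun U hU hUb => ?_⟩, ?_⟩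
  · obtain ⟨C, hC⟩ := h.bounded _ hUb
    have : IsFiniteMeasure (μ.restrict U) :=
      ⟨by rw [Measure.restrict_apply_univ]; exact (hC U hU subset_rfl).trans_lt ENNReal.coe_lt_top⟩
    exact ((Lp.memLp f).restrict U).mono_exponent le_top
  · rintro ξ ⟨U, hU, hUb, hξ⟩
    have hfin : (κ '' U).Finite := by
      rcases U.eq_empty_or_nonempty with rfl | ⟨x, hx⟩
      · simp
      · refine (h.isUniformlyLocallyFinite.finite ((h.controlled_iff _).1 hUb) (κ x)).subset ?_
        rintro _ ⟨y, hy, rfl⟩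
        exact ⟨(x, y), ⟨hx, hy⟩, rfl⟩
    have hξ' : h.space.q hfin.toFinset ξ = ξ := by
      rw [q_eq_self_iff]
      filter_upwards [hξ] with x hx hxU
      exact hx fun hc => hxU (by simpa using ⟨x, hc, rfl⟩)
    have hk : ∀ᶠ S : Finset I in atTop, ∀ j ∈ κ '' U,
        h.space.q {j} ((T - mulOp f) (h.space.one S)) = 0 :=
      hfin.eventually_all.2 fun j _ => hf j
    obtain ⟨S, hS1, hS2⟩ := (hk.and (h.eventually_q_adjoint hT hfin.toFinset)).exists
    obtain ⟨h1, h2⟩ := hS2 ξ hξ'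
    have h3 := h.space.q_eq_zero_of_finite hfin hS1
    rw [h.integral_star_mul_eq_inner f h1, h.integral_star_eq_inner h2,
      ContinuousLinearMap.adjoint_inner_left, eq_comm, ← sub_eq_zero, ← inner_sub_right,
      ← sub_apply, ← hξ', h.space.inner_q_left,
      Finite.coe_toFinset, h3, inner_zero_right]

/-- Operators supported on an equivalence relation with controlled classes are in blocks. -/
lemma exists_isInBlocks {E₀ : Set (I × I)} {ε : ℝ≥0}
    (hε : ∀ i, (ε : ℝ≥0∞) ≤ μ (κ ⁻¹' {i})) (r : Setoid I) (hr : {p : I × I | r p.1 p.2} ⊆ E₀)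
    {T : L2 μ →L[ℂ] L2 μ} (hT : BlockSupp h.space h.space T {p | r p.1 p.2}) :
    IsInBlocks (Prod.map κ κ ⁻¹' E₀) ε T := by
  -- The blocks are the preimages of the classes. Each class is nonempty, so its preimage contains a
  -- whole fibre and has measure at least `ε`.
  refine ⟨(fun s => κ ⁻¹' s) '' r.classes, ⟨?_, ?_, ?_, ?_⟩, ?_⟩
  · rintro _ ⟨s, -, rfl⟩
    exact h.measurable s
  · rintro _ ⟨s, ⟨j, rfl⟩, rfl⟩ ⟨x, y⟩ ⟨hx, hy⟩
    exact hr (r.trans (show r (κ x) j from hx) (r.symm (show r (κ y) j from hy)))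
  · rintro _ ⟨s, hs, rfl⟩ _ ⟨t, ht, rfl⟩ hst
    refine Disjoint.preimage κ ?_
    by_contra hc
    obtain ⟨i, hi, hi'⟩ := not_disjoint_iff.1 hc
    exact hst (congrArg _ (r.eq_of_mem_classes hs hi ht hi'))
  · rintro _ ⟨s, ⟨j, rfl⟩, rfl⟩
    rw [ENNReal.ofReal_coe_nnreal]
    refine (hε j).trans (measure_mono (preimage_mono ?_))
    rintro _ rfl
    exact r.refl _
  · convert h.isSupportedOn_of_blockSupp hT using 1
    ext ⟨x, y⟩
    simp only [mem_iUnion, mem_image, exists_prop, mem_prod]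
    constructor
    · rintro ⟨_, ⟨s, ⟨j, rfl⟩, rfl⟩, hx, hy⟩
      exact r.trans (show r (κ y) j from hy) (r.symm (show r (κ x) j from hx))
    · intro hxy
      exact ⟨_, ⟨_, r.mem_classes (κ x), rfl⟩, r.refl _, hxy⟩

lemma blockSupp_of_isInBlocks {E : Set (X × X)} {ε : ℝ} {T : L2 μ →L[ℂ] L2 μ}
    (hT : IsInBlocks E ε T) :
    BlockSupp h.space h.space T {p | (p.2, p.1) ∈ Prod.map κ κ '' E} := by
  obtain ⟨𝒜, h𝒜, hT⟩ := hT
  refine (h.blockSupp_of_isSupportedOn hT).mono fun p hp => ?_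
  refine image_mono ?_ hp
  exact iUnion₂_subset fun A hA => h𝒜.2.1 A hA

end IsBlockMap

end MeasureBlocks

/-! ### The averaging operator between two discretised spaces -/

noncomputable section BlockLift

variable {I : Type*} [CoarseSpace I]
  {X : Type u} [CoarseSpace X] {mX : MeasurableSpace X} {μ : Measure X} {κ : X → I}
  {X' : Type u} [CoarseSpace X'] {mX' : MeasurableSpace X'} {μ' : Measure X'} {κ' : X' → I}

namespace IsBlockMap

/-- The mean value over a block. -/
def mean (h : IsBlockMap μ κ) (i : I) (ξ : L2 μ) : ℂ :=
  inner ℂ (h.space.one {i}) ξ / (μ.real (κ ⁻¹' {i}) : ℂ)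

lemma real_fiber_pos (h : IsBlockMap μ κ) (i : I) : 0 < μ.real (κ ⁻¹' {i}) :=
  ENNReal.toReal_pos (h.measure_fiber_ne_zero i) (h.measure_fiber_lt_top i).ne

lemma norm_one_sq (h : IsBlockMap μ κ) (S : Finset I) :
    ‖h.space.one S‖ ^ 2 = μ.real (κ ⁻¹' S) := by
  change ‖indicatorConstLp 2 (h.measurable S) (h.measure_preimage_finset_ne_top S) (1 : ℂ)‖ ^ 2 = _
  rw [norm_indicatorConstLp (by norm_num) (by norm_num), norm_one, one_mul, ← Real.rpow_natCast,
    ← Real.rpow_mul measureReal_nonneg]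
  norm_num

/-- Cauchy–Schwarz on one fibre, with `‖one {i}‖²` equal to its measure. -/
lemma norm_mean_sq_le (h : IsBlockMap μ κ) (i : I) (ξ : L2 μ) :
    ‖h.mean i ξ‖ ^ 2 * μ.real (κ ⁻¹' {i}) ≤ ‖h.space.q {i} ξ‖ ^ 2 := by
  have h0 := h.real_fiber_pos i
  have h1 : inner ℂ (h.space.one {i}) ξ = inner ℂ (h.space.one {i}) (h.space.q {i} ξ) := by
    rw [← h.space.inner_q_left, h.space.q_one {i} {i} {i} (by simp)]
  have h2 : ‖inner ℂ (h.space.one {i}) ξ‖ ≤ ‖h.space.one {i}‖ * ‖h.space.q {i} ξ‖ := by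
    rw [h1]; exact norm_inner_le_norm _ _
  have h3 := h.norm_one_sq {i}
  rw [Finset.coe_singleton] at h3
  have h4 : ‖inner ℂ (h.space.one {i}) ξ‖ ^ 2
      ≤ μ.real (κ ⁻¹' {i}) * ‖h.space.q {i} ξ‖ ^ 2 := by
    rw [← h3, ← mul_pow]
    exact pow_le_pow_left₀ (norm_nonneg _) h2 2
  rw [mean, norm_div, Complex.norm_real, Real.norm_of_nonneg h0.le, div_pow, div_mul_eq_mul_div,
    div_le_iff₀ (by positivity)]
  nlinarith

lemma tsum_enorm_mean_sq_le (h : IsBlockMap μ κ) {ε : ℝ≥0}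
    (hε : ∀ i, (ε : ℝ≥0∞) ≤ μ (κ ⁻¹' {i})) (ξ : L2 μ) :
    (∑' i, ‖h.mean i ξ‖ₑ ^ 2) * ε ≤ ‖ξ‖ₑ ^ 2 := by
  rw [← ENNReal.tsum_mul_right]
  rw [ENNReal.tsum_eq_iSup_sum]
  refine iSup_le fun S => ?_
  have h1 : ∀ i, ‖h.mean i ξ‖₊ ^ 2 * ε ≤ ‖h.space.q {i} ξ‖₊ ^ 2 := fun i => by
    rw [← NNReal.coe_le_coe]
    push_cast
    refine le_trans ?_ (h.norm_mean_sq_le i ξ)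
    refine mul_le_mul_of_nonneg_left ?_ (by positivity)
    have := ENNReal.toReal_mono (h.measure_fiber_lt_top i).ne (hε i)
    exact this
  have h2 : ∑ i ∈ S, ‖h.space.q {i} ξ‖₊ ^ 2 ≤ ‖ξ‖₊ ^ 2 := by
    rw [← NNReal.coe_le_coe]
    push_cast
    exact h.space.sum_norm_q_sq_le S ξ
  have h3 := (Finset.sum_le_sum fun i (_ : i ∈ S) => h1 i).trans h2
  simp only [enorm_eq_nnnorm]
  exact_mod_cast h3

/-- If `Φ(T)` is bounded, then its `L²`-norms over the blocks are controlled by `‖T‖`. -/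
lemma exists_norm_mulOp_one_sq_le (h : IsBlockMap μ κ)
    {E : Set (I × I)} (hE : CoarseSpace.IsControlled E) :
    ∃ C : ℝ≥0, ∀ (T : L2 μ →L[ℂ] L2 μ) (f : Lp ℂ ∞ μ), BlockSupp h.space h.space T E → IsPhi T f →
      ∀ i, ‖mulOp f (h.space.one {i})‖ ^ 2 ≤ C * ‖T‖ ^ 2 := by
  obtain ⟨C, hC⟩ := h.exists_measure_section_le hE
  refine ⟨C, fun T f hT hf i => ?_⟩
  have hfin := h.isUniformlyLocallyFinite.finite hE i
  obtain ⟨S, ⟨hS1, hS2⟩, hS3⟩ := ((h.killsOne_of_isPhi ⟨E, hE, hT⟩ hf i).and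
    (h.space.eventually_q_one hfin)).and (h.space.eventually_q_one (finite_singleton i)) |>.exists
  -- On block `i`, `Φ(T)` is `T` applied to the indicator of the section of `E` at `i`, whose
  -- measure is at most `C`.
  have h1 : mulOp f (h.space.one {i}) = h.space.q {i} (T (h.space.one hfin.toFinset)) := by
    have h2 : ((finite_singleton i).toFinset : Finset I) = {i} := by ext; simp
    rw [sub_apply, map_sub, sub_eq_zero] at hS1
    rw [← h2, ← hS3, h.mulOp_q, ← hS1, ← hS2]
    exact hT.apply_eq (by simp) _
  rw [h1]
  calc ‖h.space.q {i} (T (h.space.one hfin.toFinset))‖ ^ 2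
      ≤ (‖T‖ * ‖h.space.one hfin.toFinset‖) ^ 2 :=
        pow_le_pow_left₀ (norm_nonneg _) ((h.space.norm_q_apply_le _ _).trans (T.le_opNorm _)) 2
    _ = μ.real (κ ⁻¹' {j | (i, j) ∈ E}) * ‖T‖ ^ 2 := by
        rw [mul_pow, h.norm_one_sq, Finite.coe_toFinset, mul_comm]
    _ ≤ C * ‖T‖ ^ 2 := by
        gcongr
        have := ENNReal.toReal_mono ENNReal.coe_ne_top (hC i)
        exact this

variable [Countable I]

lemma lintegral_eq_tsum_fiber (h : IsBlockMap μ κ) (F : X → ℝ≥0∞) :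
    ∫⁻ x, F x ∂μ = ∑' i, ∫⁻ x in κ ⁻¹' {i}, F x ∂μ := by
  rw [← lintegral_iUnion (fun i => h.measurable {i}), ← preimage_iUnion]
  · simp [iUnion_of_singleton]
  · intro i j hij
    exact Disjoint.preimage κ (by simpa using hij)

/-- The mean is constant on each fibre and factors out, so only the `L²` norm of `g` over fibres
enters, not its supremum. With `g = 1` this bounds the lift; with `g = f` it bounds `M_f` after the
lift. -/
lemma lintegral_mul_mean_le (h : IsBlockMap μ κ) (h' : IsBlockMap μ' κ') {ε : ℝ≥0}
    (hε : ∀ i, (ε : ℝ≥0∞) ≤ μ' (κ' ⁻¹' {i})) {g : X → ℂ} {K : ℝ≥0}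
    (hK : ∀ i, ∫⁻ x in κ ⁻¹' {i}, ‖g x‖ₑ ^ 2 ∂μ ≤ K) (ξ : L2 μ') :
    (∫⁻ x, ‖g x * h'.mean (κ x) ξ‖ₑ ^ 2 ∂μ) * ε ≤ K * ‖ξ‖ₑ ^ 2 := by
  have h1 : ∀ i, ∫⁻ x in κ ⁻¹' {i}, ‖g x * h'.mean (κ x) ξ‖ₑ ^ 2 ∂μ
      ≤ K * ‖h'.mean i ξ‖ₑ ^ 2 := fun i => by
    have h2 : ∫⁻ x in κ ⁻¹' {i}, ‖g x * h'.mean (κ x) ξ‖ₑ ^ 2 ∂μ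
        = ∫⁻ x in κ ⁻¹' {i}, ‖g x‖ₑ ^ 2 * ‖h'.mean i ξ‖ₑ ^ 2 ∂μ := by
      refine setLIntegral_congr_fun (h.measurable {i}) fun x hx => ?_
      have hx' : κ x = i := hx
      simp only [hx', enorm_mul, mul_pow]
    rw [h2, lintegral_mul_const' _ _ (by simp)]
    exact mul_le_mul_left (hK i) _
  rw [h.lintegral_eq_tsum_fiber]
  calc (∑' i, ∫⁻ x in κ ⁻¹' {i}, ‖g x * h'.mean (κ x) ξ‖ₑ ^ 2 ∂μ) * ε
      ≤ (∑' i, K * ‖h'.mean i ξ‖ₑ ^ 2) * ε := by gcongr with i; exact h1 i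
    _ = K * ((∑' i, ‖h'.mean i ξ‖ₑ ^ 2) * ε) := by rw [ENNReal.tsum_mul_left, mul_assoc]
    _ ≤ K * ‖ξ‖ₑ ^ 2 := by gcongr; exact h'.tsum_enorm_mean_sq_le hε ξ

lemma norm_le_of_ae_eq_mul_mean (h : IsBlockMap μ κ) (h' : IsBlockMap μ' κ') {ε : ℝ≥0}
    (hε0 : 0 < ε) (hε : ∀ i, (ε : ℝ≥0∞) ≤ μ' (κ' ⁻¹' {i})) {g : X → ℂ}
    {K : ℝ≥0}
    (hK : ∀ i, ∫⁻ x in κ ⁻¹' {i}, ‖g x‖ₑ ^ 2 ∂μ ≤ K) (ξ : L2 μ') (η : L2 μ)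
    (hη : η =ᵐ[μ] fun x => g x * h'.mean (κ x) ξ) : ‖η‖ ≤ √(K / ε) * ‖ξ‖ := by
  have h1 := h.lintegral_mul_mean_le h' hε hK ξ
  have h2 : ‖η‖ₑ ^ 2 = ∫⁻ x, ‖g x * h'.mean (κ x) ξ‖ₑ ^ 2 ∂μ := by
    rw [enorm_sq_eq_lintegral]
    refine lintegral_congr_ae ?_
    filter_upwards [hη] with x hx
    rw [hx]
  rw [← h2] at h1
  simp only [enorm_eq_nnnorm] at h1
  have h3 : ‖η‖₊ ^ 2 * ε ≤ K * ‖ξ‖₊ ^ 2 := by exact_mod_cast h1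
  have h4 : ‖η‖ ^ 2 * ε ≤ K * ‖ξ‖ ^ 2 := by exact_mod_cast h3
  refine abs_le_of_sq_le_sq' ?_ (by positivity) |>.2
  rw [mul_pow, Real.sq_sqrt (by positivity), div_mul_eq_mul_div, le_div_iff₀ (by exact_mod_cast hε0)]
  exact h4

lemma memLp_mean (h : IsBlockMap μ κ) (h' : IsBlockMap μ' κ') (ξ : L2 μ') :
    MemLp (fun x => h'.mean (κ x) ξ) 2 μ := by
  have hm : Measurable fun x => h'.mean (κ x) ξ := fun s _ =>
    h.measurable ((fun i => h'.mean i ξ) ⁻¹' s)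
  refine ⟨hm.aestronglyMeasurable, ?_⟩
  obtain ⟨ε, hε0, hε⟩ := h'.lower
  obtain ⟨C, hC⟩ := h.exists_measure_fiber_le
  have h1 := h.lintegral_mul_mean_le h' hε (g := fun _ => 1)
    (K := C) (by simpa using hC) ξ
  have h2 := eLpNorm_nnreal_pow_eq_lintegral (f := fun x => h'.mean (κ x) ξ) (μ := μ) (p := 2)
    two_ne_zero
  simp only [one_mul] at h1
  have h3 : (eLpNorm (fun x => h'.mean (κ x) ξ) 2 μ) ^ 2 * ε ≤ C * ‖ξ‖ₑ ^ 2 := by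
    refine le_trans (le_of_eq ?_) h1
    congr 1
    simpa using h2
  by_contra hc
  rw [not_lt, top_le_iff] at hc
  rw [hc, ENNReal.top_pow two_ne_zero, ENNReal.top_mul (by exact_mod_cast hε0.ne'), top_le_iff] at h3
  exact ENNReal.mul_ne_top ENNReal.coe_ne_top (by simp) h3

/-- The operator that replaces a function by its mean values over the blocks of one
discretisation, transplanted to the blocks of the other one. -/
def lift (h : IsBlockMap μ κ) (h' : IsBlockMap μ' κ') : L2 μ' →L[ℂ] L2 μ :=
  LinearMap.mkContinuousOfExistsBound
    { toFun := fun ξ => (h.memLp_mean h' ξ).toLp _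
      map_add' := fun ξ η => by
        rw [← MemLp.toLp_add]
        refine MemLp.toLp_congr _ _ (Eventually.of_forall fun x => ?_)
        simp [mean, inner_add_right, add_div]
      map_smul' := fun c ξ => by
        rw [RingHom.id_apply, ← MemLp.toLp_const_smul]
        refine MemLp.toLp_congr _ _ (Eventually.of_forall fun x => ?_)
        simp [mean, inner_smul_right, mul_div_assoc] } (by
    obtain ⟨ε, hε0, hε⟩ := h'.lower
    obtain ⟨C, hC⟩ := h.exists_measure_fiber_le
    refine ⟨√(C / ε), fun ξ => h.norm_le_of_ae_eq_mul_mean h' hε0 hε (g := fun _ => 1)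
      (by simpa using hC) ξ _ ?_⟩
    simp only [one_mul]
    exact MemLp.coeFn_toLp (h.memLp_mean h' ξ))

variable (h : IsBlockMap μ κ) (h' : IsBlockMap μ' κ')

lemma coeFn_lift (ξ : L2 μ') : h.lift h' ξ =ᵐ[μ] fun x => h'.mean (κ x) ξ :=
  MemLp.coeFn_toLp (h.memLp_mean h' ξ)

/-- On a fibre the mean of `one S` is `1` or `0`, according to whether the index lies in `S`. -/
lemma lift_one (S : Finset I) : h.lift h' (h'.space.one S) = h.space.one S := by
  classical
  refine Lp.ext ?_
  filter_upwards [h.coeFn_lift h' (h'.space.one S), h.coeFn_one S] with x h1 h2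
  have h3 : h'.space.one {κ x} = h'.space.q {κ x} (h'.space.one {κ x}) :=
    (h'.space.q_one {κ x} {κ x} {κ x} (by simp)).symm
  rw [h1, h2, mean, h3, h'.space.inner_q_left]
  have h4 := h'.real_fiber_pos (κ x)
  by_cases hx : κ x ∈ S
  · rw [h'.space.q_one {κ x} S {κ x} (by simpa using hx), inner_self_eq_norm_sq_to_K,
      indicator_of_mem (by simpa using hx)]
    have h5 := h'.norm_one_sq {κ x}
    rw [Finset.coe_singleton] at h5
    rw [← h5] at h4 ⊢
    push_cast
    exact div_self (pow_ne_zero 2 (Complex.ofReal_ne_zero.2 (ne_zero_pow two_ne_zero h4.ne')))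
  · have h6 : ((∅ : Finset I) : Set I) = {κ x} ∩ (S : Set I) := by
      rw [Finset.coe_empty, eq_comm, singleton_inter_eq_empty]
      exact hx
    have h7 : h'.space.one ∅ = 0 := by
      have := h'.norm_one_sq ∅
      simpa using this
    rw [h'.space.q_one {κ x} S ∅ h6, h7, inner_zero_right, zero_div,
      indicator_of_notMem (by simpa using hx)]

lemma blockSupp_lift : BlockSupp h'.space h.space (h.lift h') {p | p.1 = p.2} := by
  intro S T hST ξ
  rw [q_eq_zero_iff]
  filter_upwards [h.coeFn_lift h' (h'.space.q T ξ)] with x hx hxS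
  have h1 : κ x ∉ T := fun hT => hST _ hxS _ hT rfl
  have h2 : h'.space.q T (h'.space.one {κ x}) = 0 := by
    rw [← h'.space.q_one {κ x} {κ x} {κ x} (by simp), h'.space.q_apply_q,
      inter_singleton_eq_empty.2 h1]
    simp
  rw [hx, mean, ← h'.space.inner_q_left, h2, inner_zero_left, zero_div]

/-- Replaces the unavailable bound of `‖f‖_∞` by `‖T‖`: for `f = Φ(T)`, `K` can be taken
proportional to `‖T‖²`. -/
lemma norm_mulOp_lift_le {ε : ℝ≥0} (hε0 : 0 < ε) (hε : ∀ i, (ε : ℝ≥0∞) ≤ μ' (κ' ⁻¹' {i}))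
    (f : Lp ℂ ∞ μ) {K : ℝ≥0} (hK : ∀ i, ‖mulOp f (h.space.one {i})‖ ^ 2 ≤ K) :
    ‖mulOp f ∘L h.lift h'‖ ≤ √(K / ε) := by
  refine ContinuousLinearMap.opNorm_le_bound _ (Real.sqrt_nonneg _) fun ξ => ?_
  refine h.norm_le_of_ae_eq_mul_mean h' hε0 hε (g := f) (fun i => ?_) ξ _ ?_
  · have h1 : ‖mulOp f (h.space.one {i})‖ₑ ^ 2 = ∫⁻ x in κ ⁻¹' {i}, ‖f x‖ₑ ^ 2 ∂μ := by
      rw [enorm_sq_eq_lintegral, ← lintegral_indicator (h.measurable {i})]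
      refine lintegral_congr_ae ?_
      filter_upwards [coeFn_mulOp f (h.space.one {i}), h.coeFn_one {i}] with x h1 h2
      rw [h1, h2]
      by_cases hx : κ x = i <;> simp [indicator, hx]
    rw [← h1, enorm_eq_nnnorm]
    have h2 : ‖mulOp f (h.space.one {i})‖₊ ^ 2 ≤ K := by exact_mod_cast hK i
    exact_mod_cast h2
  · filter_upwards [coeFn_mulOp f (h.lift h' ξ), h.coeFn_lift h' ξ] with x h1 h2
    rw [ContinuousLinearMap.comp_apply, h1, h2]

end IsBlockMap

end BlockLift

/-! ### Transfer of property (T) along a common discretisation -/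

noncomputable section Transfer

variable {I : Type*} [CoarseSpace I]
  {X : Type u} [CoarseSpace X] {mX : MeasurableSpace X} {μ : Measure X} {κ : X → I}
  {X' : Type u} [CoarseSpace X'] {mX' : MeasurableSpace X'} {μ' : Measure X'} {κ' : X' → I}

/-- Closedness gives the orthogonal decomposition along the constant vectors. -/
lemma isClosed_constantVectors {H : Type u} [NormedAddCommGroup H] [InnerProductSpace ℂ H]
    [CompleteSpace H] (ρ : controlledAlgebra μ →⋆ₐ[ℂ] (H →L[ℂ] H)) :
    IsClosed (constantVectors ρ : Set H) := by
  have h : (constantVectors ρ : Set H) = ⋂ (T : controlledAlgebra μ) (f : Lp ℂ ∞ μ)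
      (_ : IsPhi (T : L2 μ →L[ℂ] L2 μ) f), {v | ρ T v = ρ (mulElem f) v} := by
    ext v
    simp only [mem_iInter]
    rfl
  rw [h]
  refine isClosed_iInter fun T => isClosed_iInter fun f => isClosed_iInter fun _ => ?_
  exact isClosed_eq (by fun_prop) (by fun_prop)

lemma mulElem_zero : mulElem (0 : Lp ℂ ∞ μ) = 0 :=
  Subtype.ext (map_zero ((ContinuousLinearMap.mul ℂ ℂ).holderL μ ∞ 2 2))

namespace IsBlockMap

lemma isPhi_zero_of_killsOne (h : IsBlockMap μ κ) {T : L2 μ →L[ℂ] L2 μ}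
    (hT : ControlledOp h.space h.space T) (hk : KillsOne h.space h.space T) :
    IsPhi T (0 : Lp ℂ ∞ μ) :=
  h.isPhi_of_killsOne hT (by rwa [mulOp_zero, sub_zero])

/-- A pointed representation of the algebra of controlled operators on `L²(X, μ)`. -/
abbrev pointedRep (h : IsBlockMap μ κ) {H : Type u} [NormedAddCommGroup H] [InnerProductSpace ℂ H]
    [CompleteSpace H] (ρ : controlledAlgebra μ →⋆ₐ[ℂ] (H →L[ℂ] H)) (v : H) :
    PointedRep I (L2 μ) H where
  space := h.space
  ulf := h.isUniformlyLocallyFinite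
  alg := controlledAlgebra μ
  mem_alg := h.mem_controlledAlgebra
  rep := ρ
  vec := v

variable [Countable I] (h : IsBlockMap μ κ) (h' : IsBlockMap μ' κ')

lemma controlledOp_lift : ControlledOp h'.space h.space (h.lift h') :=
  ⟨_, CoarseSpace.diagonal, h.blockSupp_lift h'⟩

lemma lift_comp_lift_one (S : Finset I) :
    (h'.lift h ∘L h.lift h') (h'.space.one S) = h'.space.one S := by
  rw [ContinuousLinearMap.comp_apply, h.lift_one, h'.lift_one]

lemma blockSupp_lift_comp_lift :
    BlockSupp h'.space h'.space (h'.lift h ∘L h.lift h') {p | p.1 = p.2} := by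
  have := (h'.blockSupp_lift h).comp (h.blockSupp_lift h')
  rwa [compRel_diagonal] at this

/-- The composite fixes every `one {i}`, which is nonzero because fibres have positive measure. It
is needed because property (T) only speaks of nonzero operators. -/
lemma lift_comp_lift_ne_zero (h1 : (1 : L2 μ' →L[ℂ] L2 μ') ≠ 0) :
    h'.lift h ∘L h.lift h' ≠ 0 := by
  intro h0
  rcases isEmpty_or_nonempty I with hI | ⟨⟨i⟩⟩
  · refine h1 ?_
    rw [← h'.space.q_univ, univ_eq_empty_iff.2 hI, h'.space.q_empty]
  · have h2 := h.lift_comp_lift_one h' {i}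
    rw [h0, zero_apply] at h2
    have h3 := h'.norm_one_sq {i}
    rw [← h2, Finset.coe_singleton] at h3
    have h4 := h'.real_fiber_pos i
    rw [← h3] at h4
    simp at h4

section Representation

variable {H : Type u} [NormedAddCommGroup H] [InnerProductSpace ℂ H] [CompleteSpace H]
  (ρ : controlledAlgebra μ' →⋆ₐ[ℂ] (H →L[ℂ] H)) (v : H)

/-- The representation of `ℂ_cs[X]` induced from a representation of `ℂ_cs[X']`. -/
def inducedRep : controlledAlgebra μ →⋆ₐ[ℂ]
    ((h'.pointedRep ρ v).Hil h.space →L[ℂ] (h'.pointedRep ρ v).Hil h.space) :=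
  (h'.pointedRep ρ v).inducedRep (controlledAlgebra μ) h.mem_controlledAlgebra

/-- The vector of the induced representation that is given by the lifting operator. -/
def liftVec : (h'.pointedRep ρ v).Hil h.space :=
  ((h'.pointedRep ρ v).ofOp (h.lift h') (h.controlledOp_lift h') : (h'.pointedRep ρ v).Pre h.space)

/-- The map from the induced representation to the original one. -/
def descend (z : (h'.pointedRep ρ v).Hil h.space) : H :=
  (h'.pointedRep ρ v).evalH
    (PointedRep.compH (D := h'.pointedRep ρ v) (h'.lift h) (h'.controlledOp_lift h) z)

lemma descend_liftVec :
    h.descend h' ρ v (h.liftVec h' ρ v) = (h'.pointedRep ρ v).act (h'.lift h ∘L h.lift h') := by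
  rw [descend, liftVec, PointedRep.compH_coe, PointedRep.evalH_coe]
  rfl

lemma descend_sub (z w : (h'.pointedRep ρ v).Hil h.space) :
    h.descend h' ρ v (z - w) = h.descend h' ρ v z - h.descend h' ρ v w := by
  rw [descend, map_sub, map_sub]; rfl

/-- Evaluation is isometric, and the reverse lift is block diagonal, so composition with it is
bounded by its operator norm. -/
lemma norm_descend_le (z : (h'.pointedRep ρ v).Hil h.space) :
    ‖h.descend h' ρ v z‖ ≤ ‖h'.lift h‖ * ‖z‖ := by
  rw [descend, PointedRep.norm_evalH]
  refine PointedRep.norm_compH_le_of_diagonal _ ?_ z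
  refine ((h'.blockSupp_lift h).adjoint.comp (h'.blockSupp_lift h)).mono ?_
  rintro ⟨i, j⟩ ⟨k, h1, h2⟩
  exact (show k = i from h1).symm.trans h2

/-- For `y = (T - M_f) lift`, with the lift from `X` to `X'`, the operator `y† y` lies in `ℂ_cs[X]`
and has `Φ(y† y) = 0`. It therefore annihilates the constant vector `z`, and `⟨z, y† y z⟩ = ‖y z‖²`
gives `y z = 0`. -/
lemma descend_mem_constantVectors {z : (h'.pointedRep ρ v).Hil h.space}
    (hz : z ∈ constantVectors (h.inducedRep h' ρ v)) :
    h.descend h' ρ v z ∈ constantVectors ρ := by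
  intro T f hf
  let D := h'.pointedRep ρ v
  have hTc : ControlledOp h'.space h'.space (T : L2 μ' →L[ℂ] L2 μ') :=
    (h'.mem_controlledAlgebra _).1 T.2
  set y : L2 μ →L[ℂ] L2 μ' := ((T - mulElem f : controlledAlgebra μ') : L2 μ' →L[ℂ] L2 μ')
    ∘L h'.lift h with hy
  have hyc : ControlledOp h.space h'.space y :=
    ((h'.mem_controlledAlgebra _).1 (T - mulElem f).2).comp (h'.controlledOp_lift h)
  have hyk : KillsOne h.space h'.space y :=
    (h'.killsOne_of_isPhi hTc hf).comp_one (h'.lift_one h)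
  have hbc : ControlledOp h.space h.space (y† ∘L y) := hyc.adjoint.comp hyc
  have hbk : KillsOne h.space h.space (y† ∘L y) :=
    hyk.controlled_comp h.isUniformlyLocallyFinite hyc.adjoint
  have h1 := hz ⟨y† ∘L y, (h.mem_controlledAlgebra _).2 hbc⟩ 0 (h.isPhi_zero_of_killsOne hbc hbk)
  rw [mulElem_zero, map_zero, zero_apply] at h1
  change PointedRep.compH (D := D) (y† ∘L y) hbc z = 0 at h1
  rw [← PointedRep.compH_compH (D := D) _ hyc.adjoint _ hyc] at h1
  have h2 : PointedRep.compH (D := D) y hyc z = 0 := by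
    rw [← inner_self_eq_zero (𝕜 := ℂ), PointedRep.inner_compH_left, h1, inner_zero_right]
  have h3 : ρ (T - mulElem f) (h.descend h' ρ v z) = 0 := by
    have h4 := PointedRep.rep_evalH (D := D) (T - mulElem f)
      (PointedRep.compH (D := D) (h'.lift h) (h'.controlledOp_lift h) z)
    rw [PointedRep.compH_compH (D := D)] at h4
    refine h4.trans ?_
    change D.evalH (PointedRep.compH (D := D) y hyc z) = 0
    rw [h2, map_zero]
  rwa [map_sub, sub_apply, sub_eq_zero] at h3

lemma norm_inducedRep_liftVec (a : controlledAlgebra μ) :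
    ‖h.inducedRep h' ρ v a (h.liftVec h' ρ v)‖ ^ 2 =
      RCLike.re (inner ℂ v ((h'.pointedRep ρ v).act
        (((a : L2 μ →L[ℂ] L2 μ) ∘L h.lift h')† ∘L ((a : L2 μ →L[ℂ] L2 μ) ∘L h.lift h')))) := by
  rw [inducedRep, PointedRep.inducedRep_apply, liftVec, PointedRep.compH_coe,
    UniformSpace.Completion.norm_coe, PointedRep.norm_sq_def]
  rfl

end Representation

/-- Geometric property (T) only depends on the discretisation. -/
theorem geometricPropertyT_of_geometricPropertyT {μ : Measure X} {μ' : Measure X'}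
    (h : IsBlockMap μ κ) (h' : IsBlockMap μ' κ') (hμ : GeometricPropertyT μ) :
    GeometricPropertyT μ' := by
  obtain ⟨E, ε, γ, hE, hε, hγ, hT⟩ := hμ
  set KE : Set (I × I) := {p | (p.2, p.1) ∈ Prod.map κ κ '' E} with hKE
  have hKEc : CoarseSpace.IsControlled KE := CoarseSpace.inverse ((h.controlled_iff E).1 hE)
  -- The diagonal accommodates `M_f`, so that `T - M_f` is supported on `K` for every admissible
  -- `T`. Thus `n` below depends on `E` only.
  set K : Set (I × I) := KE ∪ {p | p.1 = p.2} with hK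
  have hKc : CoarseSpace.IsControlled K := CoarseSpace.union hKEc CoarseSpace.diagonal
  obtain ⟨n, hn⟩ := exists_block_squares h.isUniformlyLocallyFinite hKc h'.space h.space
  obtain ⟨C₀, hC₀⟩ := h.exists_norm_mulOp_one_sq_le hKEc
  obtain ⟨ε', hε'0, hε'⟩ := h'.lower
  set C₁ : ℝ := ‖h.lift h'‖ + √(C₀ / ε') with hC₁
  have hC₁0 : 0 ≤ C₁ := by positivity
  set s : ℝ := √n * C₁ * ‖h'.lift h‖ with hs
  have hs0 : 0 ≤ s := by positivity
  -- The first term makes `lift ∘ lift` move `v` by at most `1/2`; the second makes the final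
  -- inequality contradictory.
  set γ' : ℝ := min (1 / (2 * (‖h'.lift h ∘L h.lift h'‖ + 1))) (γ / (2 * (s + 1))) with hγ'
  have hγ'0 : 0 < γ' := lt_min (by positivity) (by positivity)
  have hγ1 : γ' * ‖h'.lift h ∘L h.lift h'‖ ≤ 1 / 2 := by
    have h1 : γ' * (2 * (‖h'.lift h ∘L h.lift h'‖ + 1)) ≤ 1 :=
      (le_div_iff₀ (by positivity)).1 (min_le_left _ _)
    linarith
  have hγ2 : γ' * s < γ / 2 := by
    have h1 : γ' * (2 * (s + 1)) ≤ γ := (le_div_iff₀ (by positivity)).1 (min_le_right _ _)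
    linarith
  refine ⟨Prod.map κ' κ' ⁻¹' spread K, ε', γ', h'.controlled_preimage (isControlled_spread hKc),
    hε'0, hγ'0, fun H _ _ _ ρ v hv hv1 => ?_⟩
  by_contra hcon
  push Not at hcon
  set D := h'.pointedRep ρ v with hD
  have hblocks : ∀ (y : L2 μ' →L[ℂ] L2 μ') (f : Lp ℂ ∞ μ') (r : Setoid I), y ≠ 0 →
      {p : I × I | r p.1 p.2} ⊆ spread K → BlockSupp h'.space h'.space y {p | r p.1 p.2} →
      KillsOne h'.space h'.space (y - mulOp f) →
      ‖D.act y - ρ (mulElem f) v‖ ≤ γ' * ‖y‖ := by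
    intro y f r hy0 hr hy hk
    have hyc : ControlledOp h'.space h'.space y :=
      ⟨_, CoarseSpace.subset (isControlled_spread hKc) hr, hy⟩
    have hya := (h'.mem_controlledAlgebra _).2 hyc
    have h1 := hcon ⟨y, hya⟩ (fun hc => hy0 (congrArg Subtype.val hc))
      (h'.exists_isInBlocks hε' r hr hy) f (h'.isPhi_of_killsOne hyc hk)
    rw [PointedRep.act_mem (D := D) hya]
    rw [sub_apply] at h1
    exact h1.le
  -- If `L²(μ')` were zero, then `1 = 0` in the algebra and the unital `ρ` would force `v = 0`.
  have hH : (1 : L2 μ' →L[ℂ] L2 μ') ≠ 0 := by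
    intro hc
    have h1 : (1 : controlledAlgebra μ') = 0 := Subtype.ext hc
    have h2 : ρ 1 v = ρ 0 v := by rw [h1]
    rw [map_one, map_zero, one_apply_eq_self, zero_apply] at h2
    rw [h2, norm_zero] at hv1
    exact zero_ne_one hv1
  have hdiag : {p : I × I | (⊥ : Setoid I) p.1 p.2} = {p | p.1 = p.2} := rfl
  -- The composite of the two lifts is block diagonal with `Φ = 1`, hence an admissible block
  -- operator.
  have hnear : ‖D.act (h'.lift h ∘L h.lift h') - v‖ ≤ 1 / 2 := by
    have hone : mulElem (indTop (h'.measurable univ)) = 1 := Subtype.ext h'.space.q_univ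
    have h1 := hblocks _ (indTop (h'.measurable univ)) ⊥ (h.lift_comp_lift_ne_zero h' hH)
      (fun p hp => Or.inr hp) (h.blockSupp_lift_comp_lift h') (fun i => Eventually.of_forall fun S => by
        have h2 : mulOp (indTop (h'.measurable univ)) = 1 := h'.space.q_univ
        rw [sub_apply, h.lift_comp_lift_one h', h2, one_apply_eq_self, sub_self, map_zero])
    rw [hone, map_one, one_apply_eq_self] at h1
    exact h1.trans hγ1
  have hsmall : ∀ (y : L2 μ' →L[ℂ] L2 μ') (r : Setoid I), {p : I × I | r p.1 p.2} ⊆ spread K →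
      BlockSupp h'.space h'.space y {p | r p.1 p.2} → KillsOne h'.space h'.space y →
      ‖D.act y‖ ≤ γ' * ‖y‖ := by
    intro y r hr hy hk
    by_cases hy0 : y = 0
    · have h1 : D.act (0 : L2 μ' →L[ℂ] L2 μ') = 0 := by
        rw [PointedRep.act_mem (D := D) (zero_mem _)]
        exact congrArg (fun T : H →L[ℂ] H => T v) (map_zero ρ)
      rw [hy0, h1, norm_zero, norm_zero, mul_zero]
    · have h1 := hblocks y 0 r hy0 hr hy (by rwa [mulOp_zero, sub_zero])
      rwa [mulElem_zero, map_zero, zero_apply, sub_zero] at h1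
  set π := h.inducedRep h' ρ v with hπ
  have : CompleteSpace (constantVectors π) :=
    (isClosed_constantVectors π).completeSpace_coe
  obtain ⟨z, hz, w, hw, hzw⟩ := (constantVectors π).exists_add_mem_mem_orthogonal (h.liftVec h' ρ v)
  -- `v` is a unit vector orthogonal to the constant vector `descend z`, so Pythagoras applies.
  have hfar : 1 ≤ ‖v - h.descend h' ρ v z‖ := by
    have h1 : inner ℂ v (h.descend h' ρ v z) = 0 :=
      (Submodule.mem_orthogonal' _ _).1 hv _ (h.descend_mem_constantVectors h' ρ v hz)
    have h2 := norm_sub_sq (𝕜 := ℂ) v (h.descend h' ρ v z)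
    rw [h1, hv1, map_zero] at h2
    nlinarith [norm_nonneg (v - h.descend h' ρ v z), norm_nonneg (h.descend h' ρ v z)]
  -- `descend` sends `w` to the difference of a vector within `1/2` of `v` and one at distance at
  -- least `1` from `v`.
  have hw1 : 1 / 2 ≤ ‖h'.lift h‖ * ‖w‖ := by
    have h1 : ‖D.act (h'.lift h ∘L h.lift h') - h.descend h' ρ v z‖ ≤ ‖h'.lift h‖ * ‖w‖ := by
      rw [hD, ← h.descend_liftVec h' ρ v, ← h.descend_sub h' ρ v, hzw, add_sub_cancel_left]
      exact h.norm_descend_le h' ρ v w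
    have h2 := norm_sub_le_norm_sub_add_norm_sub v (D.act (h'.lift h ∘L h.lift h'))
      (h.descend h' ρ v z)
    rw [norm_sub_rev v (D.act _)] at h2
    linarith
  have hw0 : 0 < ‖w‖ := by
    by_contra hc
    have : ‖w‖ = 0 := le_antisymm (not_lt.1 hc) (norm_nonneg _)
    rw [this, mul_zero] at hw1
    linarith
  obtain ⟨T, hT0, hTb, f, hf, hTw⟩ := hT _ π (((‖w‖⁻¹ : ℝ) : ℂ) • w)
    (Submodule.smul_mem _ _ hw) (by
      rw [norm_smul, Complex.norm_real, norm_inv, norm_norm, inv_mul_cancel₀ hw0.ne'])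
  have hTpos : 0 < ‖(T : L2 μ →L[ℂ] L2 μ)‖ :=
    norm_pos_iff.2 fun hc => hT0 (Subtype.ext hc)
  -- The constant part `z` is annihilated by `T - M_f`, so `w` may be replaced by the full lift
  -- vector.
  have hTw' : γ * ‖(T : L2 μ →L[ℂ] L2 μ)‖ * ‖w‖ ≤ ‖π (T - mulElem f) (h.liftVec h' ρ v)‖ := by
    have h1 : π (T - mulElem f) z = 0 := by
      rw [map_sub, sub_apply, hz T f hf, sub_self]
    rw [hzw, map_add, h1, zero_add, map_sub]
    rw [map_smul, norm_smul, Complex.norm_real, norm_inv, norm_norm, ← div_eq_inv_mul,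
      le_div_iff₀ hw0] at hTw
    exact hTw
  set x : L2 μ' →L[ℂ] L2 μ :=
    ((T - mulElem f : controlledAlgebra μ) : L2 μ →L[ℂ] L2 μ) ∘L h.lift h' with hx
  have hTs := h.blockSupp_of_isInBlocks hTb
  have hxK : BlockSupp h'.space h.space x K := by
    have h1 : BlockSupp h.space h.space
        ((T - mulElem f : controlledAlgebra μ) : L2 μ →L[ℂ] L2 μ) K :=
      (hTs.mono subset_union_left).sub ((h.blockSupp_mulOp f).mono subset_union_right)
    have h2 := h1.comp (h.blockSupp_lift h')
    rwa [compRel_diagonal] at h2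
  have hxk : KillsOne h'.space h.space x :=
    (h.killsOne_of_isPhi ⟨_, hKEc, hTs⟩ hf).comp_one (h.lift_one h')
  have hxn : ‖x‖ ≤ C₁ * ‖(T : L2 μ →L[ℂ] L2 μ)‖ := by
    have h1 := h.norm_mulOp_lift_le h' hε'0 hε' f
      (K := C₀ * ‖(T : L2 μ →L[ℂ] L2 μ)‖₊ ^ 2) (by
        push_cast; exact hC₀ _ f hTs hf)
    have h2 : √(((C₀ * ‖(T : L2 μ →L[ℂ] L2 μ)‖₊ ^ 2 : ℝ≥0) : ℝ) / ε')
        = √(C₀ / ε') * ‖(T : L2 μ →L[ℂ] L2 μ)‖ := by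
      push_cast
      rw [mul_div_right_comm, Real.sqrt_mul (by positivity), Real.sqrt_sq (norm_nonneg _)]
    rw [h2] at h1
    have h3 : x = (T : L2 μ →L[ℂ] L2 μ) ∘L h.lift h' - mulOp f ∘L h.lift h' :=
      ContinuousLinearMap.sub_comp _ _ _
    have h4 := ContinuousLinearMap.opNorm_comp_le (T : L2 μ →L[ℂ] L2 μ) (h.lift h')
    rw [h3]
    refine (norm_sub_le _ _).trans ?_
    rw [hC₁]
    linarith
  obtain ⟨y, hysa, hyx, hyn, hyk, hyr⟩ := hn x hxK
  -- The squared norm is `⟨v, ρ(x† x)v⟩ = ∑ ‖ρ(y k)v‖²`, with `n` terms each at most `(γ' ‖x‖)²`.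
  have hsum : ‖π (T - mulElem f) (h.liftVec h' ρ v)‖ ≤ √n * (γ' * ‖x‖) := by
    have h1 := h.norm_inducedRep_liftVec h' ρ v (T - mulElem f)
    have hyc : ∀ k, ControlledOp h'.space h'.space (y k) := fun k => by
      obtain ⟨r, hr1, hr2⟩ := hyr k
      exact ⟨_, CoarseSpace.subset (isControlled_spread hKc) hr1, hr2⟩
    have h2 := PointedRep.re_inner_vec_act_sum_squares (D := D) hysa hyc
    rw [hyx] at h2
    have h3 := h1.trans h2
    refine abs_le_of_sq_le_sq' ?_ (by positivity) |>.2
    rw [h3, mul_pow, Real.sq_sqrt (Nat.cast_nonneg n)]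
    have h4 : ∀ k ∈ Finset.univ, ‖D.act (y k)‖ ^ 2 ≤ (γ' * ‖x‖) ^ 2 := fun k _ => by
      obtain ⟨r, hr1, hr2⟩ := hyr k
      refine pow_le_pow_left₀ (norm_nonneg _) ((hsmall (y k) r hr1 hr2 (hyk hxk k)).trans ?_) 2
      exact mul_le_mul_of_nonneg_left (hyn k) hγ'0.le
    have h5 := Finset.sum_le_card_nsmul _ _ _ h4
    simpa using h5
  have hfin : γ * ‖w‖ ≤ √n * γ' * C₁ := by
    have h1 : γ * ‖w‖ * ‖(T : L2 μ →L[ℂ] L2 μ)‖ ≤ √n * γ' * C₁ * ‖(T : L2 μ →L[ℂ] L2 μ)‖ := by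
      have h2 : √n * (γ' * ‖x‖) ≤ √n * (γ' * (C₁ * ‖(T : L2 μ →L[ℂ] L2 μ)‖)) := by gcongr
      linarith
    exact le_of_mul_le_mul_right h1 hTpos
  have h1 : γ * (1 / 2) ≤ γ * (‖h'.lift h‖ * ‖w‖) := mul_le_mul_of_nonneg_left hw1 hγ.le
  have h2 : γ * ‖w‖ * ‖h'.lift h‖ ≤ √n * γ' * C₁ * ‖h'.lift h‖ :=
    mul_le_mul_of_nonneg_right hfin (norm_nonneg _)
  rw [hs] at hγ2
  linarith

end IsBlockMap

end Transfer

/-! ### Construction of a common discretisation -/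

section Discretisation

/-- A measurable selection from a countable measurable cover. -/
lemma exists_measurable_selection {X : Type u} [MeasurableSpace X] {J : Type*} [Countable J] (B : J → Set X)
    (hB : ∀ j, MeasurableSet (B j)) (hcov : ∀ x, ∃ j, x ∈ B j) :
    ∃ κ : X → J, (∀ S : Set J, MeasurableSet (κ ⁻¹' S)) ∧ ∀ x, x ∈ B (κ x) := by
  classical
  rcases isEmpty_or_nonempty J with hJ | hJ
  · have hX : IsEmpty X := ⟨fun x => hJ.elim (hcov x).choose⟩
    exact ⟨fun x => (hX.elim x), fun S => by rw [eq_empty_of_isEmpty (_ ⁻¹' S)]; simp,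
      fun x => hX.elim x⟩
  · obtain ⟨e, he⟩ := exists_surjective_nat J
    have hcov' : ∀ x, ∃ n, x ∈ B (e n) := fun x => by
      obtain ⟨j, hj⟩ := hcov x
      obtain ⟨n, rfl⟩ := he j
      exact ⟨n, hj⟩
    -- The index chosen is the least one whose set contains the point.
    have hm := measurable_find hcov' fun n => hB (e n)
    exact ⟨fun x => e (Nat.find (hcov' x)), fun S => hm (MeasurableSet.of_discrete (s := e ⁻¹' S)),
      fun x => Nat.find_spec (hcov' x)⟩

variable {X : Type u} [CoarseSpace X]

/-- A family of points with pairwise disjoint neighbourhoods for a gordo set is countable. -/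
lemma IsGordo.countable_of_pairwiseDisjoint {mX : MeasurableSpace X} [MeasurableSingletonClass X]
    {μ : Measure X} (hc : IsCountablyBounded X) (hμ : IsUniformlyBounded μ) {F : Set (X × X)}
    (hF : IsGordo μ F) {J : Set X} (hJ : J.PairwiseDisjoint (nbhd F)) : J.Countable := by
  obtain ⟨hFc, hFs, hFm, ε, hε, hFε⟩ := hF
  have hmeas : ∀ i, MeasurableSet (nbhd F i) := fun i => by
    have h : nbhdSet F {i} = nbhd F i := by simp [nbhdSet]
    rw [← h]; exact hFm _ (measurableSet_singleton i)
  obtain ⟨B, hB, hBu⟩ := hc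
  have hfin : ∀ n, (J ∩ B n).Finite := by
    intro n
    by_contra hinf
    obtain ⟨C, hC⟩ := hμ (compRel (compRel F (B n ×ˢ B n)) F)
      (CoarseSpace.comp (CoarseSpace.comp hFc (hB n)) hFc)
    -- All neighbourhoods of points of `B n` lie in one bounded set of measure at most `C`; more
    -- than `C / ε` disjoint ones cannot fit.
    obtain ⟨k, hk⟩ := exists_nat_gt (C / ε)
    obtain ⟨t, htJ, htk⟩ := Set.Infinite.exists_subset_card_eq hinf k
    have h1 : μ (⋃ i ∈ t, nbhd F i) = ∑ i ∈ t, μ (nbhd F i) :=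
      measure_biUnion_finset (hJ.subset fun i hi => (htJ hi).1) fun i _ => hmeas i
    have h2 : μ (⋃ i ∈ t, nbhd F i) ≤ C := by
      refine hC _ (Finset.measurableSet_biUnion _ fun i _ => hmeas i) ?_
      rintro ⟨v, w⟩ ⟨hv, hw⟩
      simp only [mem_iUnion, nbhd, mem_ofPred_eq, exists_prop] at hv hw
      obtain ⟨i, hi, hvi⟩ := hv
      obtain ⟨j, hj, hwj⟩ := hw
      exact ⟨j, ⟨i, hvi, (htJ hi).2, (htJ hj).2⟩, (hFs _ _).1 hwj⟩
    have h3 : (t.card : ℝ≥0∞) * ε ≤ ∑ i ∈ t, μ (nbhd F i) := by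
      rw [← nsmul_eq_mul]
      exact Finset.card_nsmul_le_sum _ _ _ fun i _ => hFε i
    rw [← h1, htk] at h3
    have h4 : (k : ℝ≥0) * ε ≤ C := by exact_mod_cast h3.trans h2
    exact absurd h4 (not_le.2 ((div_lt_iff₀ hε).1 hk))
  have hJu : J = ⋃ n, J ∩ B n := by rw [← inter_iUnion, hBu, inter_univ]
  rw [hJu]
  exact countable_iUnion fun n => (hfin n).countable

lemma IsGordo.nbhd_nonempty {mX : MeasurableSpace X} {μ : Measure X} {F : Set (X × X)}
    (hF : IsGordo μ F) (x : X) : (nbhd F x).Nonempty := by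
  obtain ⟨-, -, -, ε, hε, hFε⟩ := hF
  by_contra h
  rw [not_nonempty_iff_eq_empty] at h
  have := hFε x
  rw [h, measure_empty] at this
  exact absurd this (by simpa using hε.ne')

lemma IsGordo.measurableSet_nbhd {mX : MeasurableSpace X} [MeasurableSingletonClass X]
    {μ : Measure X} {F : Set (X × X)} (hF : IsGordo μ F) (x : X) : MeasurableSet (nbhd F x) := by
  have h : nbhdSet F {x} = nbhd F x := by simp [nbhdSet]
  rw [← h]; exact hF.2.2.1 _ (measurableSet_singleton x)

/-- The preimage of a controlled set under a coarse equivalence is controlled. -/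
lemma isControlled_preimage_of_inverse {X' : Type u} [CoarseSpace X'] {f : X → X'} {g : X' → X}
    (hg : ∀ F : Set (X' × X'), CoarseSpace.IsControlled F →
      CoarseSpace.IsControlled (Prod.map g g '' F))
    (hgf : CoarseSpace.IsControlled (range fun x => (x, g (f x)))) {K : Set (X' × X')}
    (hK : CoarseSpace.IsControlled K) : CoarseSpace.IsControlled (Prod.map f f ⁻¹' K) := by
  refine CoarseSpace.subset (CoarseSpace.comp (CoarseSpace.comp hgf (hg K hK))
    (CoarseSpace.inverse hgf)) ?_
  rintro ⟨x, y⟩ hxy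
  exact ⟨g (f y), ⟨g (f x), ⟨x, rfl⟩, ⟨(f x, f y), hxy, rfl⟩⟩, ⟨y, rfl⟩⟩

/-- The coarse structure induced by a map. -/
abbrev CoarseSpace.induced {I : Type*} (ι : I → X) : CoarseSpace I where
  IsControlled E := CoarseSpace.IsControlled (Prod.map ι ι '' E)
  diagonal := CoarseSpace.subset CoarseSpace.diagonal (by
    rintro _ ⟨⟨i, j⟩, h, rfl⟩
    exact congrArg ι h)
  subset hE hF := CoarseSpace.subset hE (image_mono hF)
  inverse hE := CoarseSpace.subset (CoarseSpace.inverse hE) (by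
    rintro _ ⟨⟨i, j⟩, h, rfl⟩
    exact ⟨(j, i), h, rfl⟩)
  union hE hF := by rw [image_union]; exact CoarseSpace.union hE hF
  comp hE hF := CoarseSpace.subset (CoarseSpace.comp hE hF) (by
    rintro _ ⟨⟨i, j⟩, ⟨k, h1, h2⟩, rfl⟩
    exact ⟨ι k, ⟨(i, k), h1, rfl⟩, ⟨(k, j), h2, rfl⟩⟩)

/-- A measurable map to a set of points with disjoint neighbourhoods that maps these neighbourhoods
to their centres and moves points by a controlled distance. -/
lemma exists_measurable_retraction {mX : MeasurableSpace X} [MeasurableSingletonClass X]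
    {μ : Measure X} (hc : IsCountablyBounded X) (hμ : IsUniformlyBounded μ) {F : Set (X × X)}
    (hF : IsGordo μ F) {I : Type*} [Countable I] (ι : I → X)
    (hι : ∀ i j, ∀ x ∈ nbhd F (ι i), x ∈ nbhd F (ι j) → i = j) {G : Set (X × X)}
    (hG : CoarseSpace.IsControlled G) (hcov : ∀ x, ∃ i, (x, ι i) ∈ G) :
    ∃ κ : X → I, (∀ S : Set I, MeasurableSet (κ ⁻¹' S)) ∧
      (∀ i, nbhd F (ι i) ⊆ κ ⁻¹' {i}) ∧
      CoarseSpace.IsControlled (range fun x => (x, ι (κ x))) := by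
  obtain ⟨J, hJc, hJ⟩ := exists_countable_cover hc hμ hF
  have : Countable J := hJc.to_subtype
  choose a ha using hcov
  have hU : MeasurableSet (⋃ i, nbhd F (ι i)) :=
    MeasurableSet.iUnion fun i => hF.measurableSet_nbhd _
  have hFF : ∀ j, MeasurableSet (nbhd (compRel F F) j) := fun j => by
    have h : nbhdSet (compRel F F) {j} = nbhd (compRel F F) j := by simp [nbhdSet]
    rw [← h, nbhdSet_compRel]
    exact hF.2.2.1 _ (hF.2.2.1 _ (measurableSet_singleton j))
  -- The neighbourhoods of the centres come first. The sections of `G` need not be measurable, so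
  -- the remainder is cut by a countable measurable cover, and each of its pieces is sent to a
  -- centre `G`-close to the index `j` of the piece.
  let B : I ⊕ J → Set X := Sum.elim (fun i => nbhd F (ι i))
    fun j => nbhd (compRel F F) j \ ⋃ i, nbhd F (ι i)
  obtain ⟨σ, hσm, hσ⟩ := exists_measurable_selection B
    (by
      rintro (i | j)
      · exact hF.measurableSet_nbhd _
      · exact (hFF j).diff hU)
    (by
      intro x
      by_cases hx : x ∈ ⋃ i, nbhd F (ι i)
      · obtain ⟨i, hi⟩ := mem_iUnion.1 hx
        exact ⟨Sum.inl i, hi⟩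
      · obtain ⟨j, hj, hxj⟩ := hJ x
        exact ⟨Sum.inr ⟨j, hj⟩, hxj, hx⟩)
  refine ⟨fun x => Sum.elim id (fun j : J => a j) (σ x), fun S => hσm (Sum.elim id (fun j : J => a j) ⁻¹' S), fun i x hx => ?_, ?_⟩
  · have h := hσ x
    change Sum.elim id (fun j : J => a j) (σ x) = i
    cases hs : σ x with
    | inl i' =>
      rw [hs] at h
      exact hι i' i x h hx
    | inr j =>
      rw [hs] at h
      exact absurd (mem_iUnion.2 ⟨i, hx⟩) h.2
  · refine CoarseSpace.subset (CoarseSpace.union hF.1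
      (CoarseSpace.comp (CoarseSpace.comp hF.1 hF.1) hG)) ?_
    rintro _ ⟨x, rfl⟩
    have h := hσ x
    cases hs : σ x with
    | inl i =>
      rw [hs] at h
      exact Or.inl (by simp only [hs]; exact h)
    | inr j =>
      rw [hs] at h
      exact Or.inr ⟨j, h.1, by simpa [hs] using ha j⟩

/-- Moving points by a controlled distance makes `κ` a coarse inverse of `ι`, so it detects
controlled sets; each fibre contains a full gordo neighbourhood, whence the lower bound. -/
lemma isBlockMap_of_retraction {mX : MeasurableSpace X} {μ : Measure X}
    (hμ : IsUniformlyBounded μ) {F : Set (X × X)} (hF : IsGordo μ F) {I : Type*} [CoarseSpace I]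
    {ι : I → X} (hι : ∀ E : Set (I × I), CoarseSpace.IsControlled E ↔
      CoarseSpace.IsControlled (Prod.map ι ι '' E)) {κ : X → I}
    (hκm : ∀ S : Set I, MeasurableSet (κ ⁻¹' S)) (hκF : ∀ i, nbhd F (ι i) ⊆ κ ⁻¹' {i})
    (hκ : CoarseSpace.IsControlled (range fun x => (x, ι (κ x)))) : IsBlockMap μ κ where
  measurable := hκm
  controlled_iff E := by
    rw [hι]
    constructor
    · intro hE
      refine CoarseSpace.subset (CoarseSpace.comp (CoarseSpace.comp (CoarseSpace.inverse hκ) hE)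
        hκ) ?_
      rintro _ ⟨_, ⟨⟨x, y⟩, hxy, rfl⟩, rfl⟩
      exact ⟨y, ⟨x, ⟨x, rfl⟩, hxy⟩, ⟨y, rfl⟩⟩
    · intro hE
      refine CoarseSpace.subset (CoarseSpace.comp (CoarseSpace.comp hκ hE)
        (CoarseSpace.inverse hκ)) ?_
      rintro ⟨x, y⟩ hxy
      exact ⟨ι (κ y), ⟨ι (κ x), ⟨x, rfl⟩, ⟨_, ⟨_, hxy, rfl⟩, rfl⟩⟩, ⟨y, rfl⟩⟩
  lower := by
    obtain ⟨-, -, -, ε, hε, hFε⟩ := hF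
    exact ⟨ε, hε, fun i => (hFε (ι i)).trans (measure_mono (hκF i))⟩
  bounded := hμ

/-- Coarsely equivalent spaces have a common discretisation. -/
theorem exists_common_blockMap {X' : Type u} [CoarseSpace X'] {mX : MeasurableSpace X}
    [MeasurableSingletonClass X] {mX' : MeasurableSpace X'} [MeasurableSingletonClass X']
    {μ : Measure X} {μ' : Measure X'} (hc : IsCountablyBounded X) (hc' : IsCountablyBounded X')
    (hμ : IsUniformlyBounded μ) (hμ' : IsUniformlyBounded μ')
    (hg : ∃ F : Set (X × X), IsGordo μ F) (hg' : ∃ F : Set (X' × X'), IsGordo μ' F)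
    (hXX' : CoarselyEquivalent X X') :
    ∃ (I : Type u) (_ : CoarseSpace I) (κ : X → I) (κ' : X' → I),
      Countable I ∧ IsBlockMap μ κ ∧ IsBlockMap μ' κ' := by
  obtain ⟨F, hF⟩ := hg
  obtain ⟨F', hF'⟩ := hg'
  obtain ⟨f, g, hf, hg, hgf, hfg⟩ := hXX'
  -- Disjointness is demanded in `X` and, after applying `f`, in `X'`, so that one index set serves
  -- both measures.
  obtain ⟨J, hJ⟩ := zorn_subset {J : Set X | J.PairwiseDisjoint (nbhd F) ∧
      J.PairwiseDisjoint fun x => nbhd F' (f x)} (by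
    intro c hc hchain
    refine ⟨⋃₀ c, ⟨?_, ?_⟩, fun s hs => subset_sUnion_of_mem hs⟩
    · exact (pairwiseDisjoint_sUnion hchain.directedOn).2 fun s hs => (hc hs).1
    · exact (pairwiseDisjoint_sUnion hchain.directedOn).2 fun s hs => (hc hs).2)
  have hJd : J.PairwiseDisjoint (nbhd F) := hJ.prop.1
  have hJd' : J.PairwiseDisjoint fun x => nbhd F' (f x) := hJ.prop.2
  have hJc : J.Countable := hF.countable_of_pairwiseDisjoint hc hμ hJd
  -- By maximality a point outside `J` violates one of the two disjointness conditions against some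
  -- `i` in `J`. Both alternatives are controlled in `X`, the second because `f` is a coarse
  -- equivalence.
  set G : Set (X × X) := compRel F F ∪ Prod.map f f ⁻¹' compRel F' F' with hG
  have hGc : CoarseSpace.IsControlled G := CoarseSpace.union (CoarseSpace.comp hF.1 hF.1)
    (isControlled_preimage_of_inverse hg hgf (CoarseSpace.comp hF'.1 hF'.1))
  have hcov : ∀ x, ∃ i : J, (x, (i : X)) ∈ G := by
    intro x
    by_cases hx : x ∈ J
    · obtain ⟨y, hy⟩ := hF.nbhd_nonempty x
      exact ⟨⟨x, hx⟩, Or.inl ⟨y, (hF.2.1 _ _).1 hy, hy⟩⟩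
    · by_contra hcon
      push Not at hcon
      refine hx (hJ.le_of_ge (y := insert x J) ⟨?_, ?_⟩ (subset_insert _ _) (mem_insert _ _))
      · refine hJd.insert fun i hi _ => ?_
        rw [disjoint_left]
        intro y hy hy'
        exact hcon ⟨i, hi⟩ (Or.inl ⟨y, (hF.2.1 _ _).1 hy, hy'⟩)
      · refine hJd'.insert fun i hi _ => ?_
        rw [disjoint_left]
        intro y hy hy'
        exact hcon ⟨i, hi⟩ (Or.inr ⟨y, (hF'.2.1 _ _).1 hy, hy'⟩)
  have : Countable J := hJc.to_subtype
  let ι : J → X := Subtype.val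
  obtain ⟨κ, hκm, hκF, hκ⟩ := exists_measurable_retraction hc hμ hF ι
    (fun i j x hi hj => by
      by_contra hij
      exact disjoint_left.1 (hJd i.2 j.2 fun h => hij (Subtype.ext h)) hi hj) hGc hcov
  obtain ⟨κ', hκm', hκF', hκ'⟩ := exists_measurable_retraction hc' hμ' hF' (fun i => f (ι i))
    (fun i j x hi hj => by
      by_contra hij
      exact disjoint_left.1 (hJd' i.2 j.2 fun h => hij (Subtype.ext h)) hi hj)
    -- A point `x'` is close to `f (g x')`, and `g x'` is `G`-close to some point of `J`.
    (CoarseSpace.comp hfg (hf G hGc)) (fun x' => by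
      obtain ⟨i, hi⟩ := hcov (g x')
      exact ⟨i, f (g x'), ⟨x', rfl⟩, ⟨_, hi, rfl⟩⟩)
  let _ : CoarseSpace J := CoarseSpace.induced ι
  refine ⟨J, inferInstance, κ, κ', inferInstance,
    isBlockMap_of_retraction hμ hF (fun E => Iff.rfl) hκm hκF hκ,
    isBlockMap_of_retraction hμ' hF' (ι := fun i => f (ι i)) (fun E => ?_) hκm' hκF' hκ'⟩
  change CoarseSpace.IsControlled (Prod.map ι ι '' E) ↔ _
  have h : Prod.map (fun i => f (ι i)) (fun i => f (ι i)) '' E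
      = Prod.map f f '' (Prod.map ι ι '' E) := by
    rw [image_image]; rfl
  rw [h]
  exact ⟨hf _, fun hE => CoarseSpace.subset (isControlled_preimage_of_inverse hg hgf hE)
    (subset_preimage_image _ _)⟩

lemma CoarselyEquivalent.symm {X' : Type u} [CoarseSpace X'] (h : CoarselyEquivalent X X') :
    CoarselyEquivalent X' X := by
  obtain ⟨f, g, hf, hg, hgf, hfg⟩ := h
  exact ⟨g, f, hg, hf, hfg, hgf⟩

variable (X) in
lemma CoarselyEquivalent.refl : CoarselyEquivalent X X := by
  have h : CoarseSpace.IsControlled (range fun x : X => (x, x)) :=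
    CoarseSpace.subset CoarseSpace.diagonal (by rintro _ ⟨x, rfl⟩; rfl)
  exact ⟨id, id, fun E hE => by simpa using hE, fun E hE => by simpa using hE, h, h⟩

/-- Geometric property (T) is invariant under coarse equivalences. -/
theorem CoarselyEquivalent.geometricPropertyT {X' : Type u} [CoarseSpace X']
    {mX : MeasurableSpace X} [MeasurableSingletonClass X] {mX' : MeasurableSpace X'}
    [MeasurableSingletonClass X'] {μ : Measure X} {μ' : Measure X'} (hXX' : CoarselyEquivalent X X')
    (hc : IsCountablyBounded X) (hc' : IsCountablyBounded X')
    (hμ : IsUniformlyBounded μ) (hμ' : IsUniformlyBounded μ')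
    (hg : ∃ F : Set (X × X), IsGordo μ F) (hg' : ∃ F : Set (X' × X'), IsGordo μ' F)
    (hT : GeometricPropertyT μ) : GeometricPropertyT μ' := by
  obtain ⟨I, _, κ, κ', _, h, h'⟩ := exists_common_blockMap hc hc' hμ hμ' hg hg' hXX'
  exact h.geometricPropertyT_of_geometricPropertyT h' hT

end Discretisation

end Coarse

/-! ### The invariance theorem -/

open Coarse
theorem mainTheorem1 {X : Type u} [CoarseSpace X] [MeasurableSpace X] [MeasurableSingletonClass X]
    (μ : Measure X) (hbg : HasBoundedGeometry X) (hcount : IsCountablyBounded X)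
    (hμ : IsUniformlyBounded μ) (hgordo : ∃ E : Set (X × X), IsGordo μ E) :
    (∀ (X' : Type u) [CoarseSpace X'] [MeasurableSpace X'] [MeasurableSingletonClass X']
      (μ' : Measure X'), HasBoundedGeometry X' → IsCountablyBounded X' →
      IsUniformlyBounded μ' → (∃ E : Set (X' × X'), IsGordo μ' E) →
      CoarselyEquivalent X X' →
      (GeometricPropertyT μ ↔ GeometricPropertyT μ')) ∧
    (∀ (m : MeasurableSpace X) (ν : @Measure X m), @MeasurableSingletonClass X m →
      IsUniformlyBounded ν → (∃ E : Set (X × X), IsGordo ν E) →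
      (GeometricPropertyT μ ↔ GeometricPropertyT ν)) := by
  refine ⟨fun X' _ _ _ μ' _ hc' hμ' hg' hXX' => ⟨?_, ?_⟩, fun m ν _ hν hg' => ⟨?_, ?_⟩⟩
  · exact hXX'.geometricPropertyT hcount hc' hμ hμ' hgordo hg'
  · exact hXX'.symm.geometricPropertyT hc' hcount hμ' hμ hg' hgordo
  -- The identity is a coarse equivalence, and the two sides may carry different σ-algebras.
  · exact (CoarselyEquivalent.refl X).geometricPropertyT (μ := μ) (μ' := ν) hcount hcount hμ hν hgordo hg'
  · exact (CoarselyEquivalent.refl X).geometricPropertyT (μ := ν) (μ' := μ) hcount hcount hν hμ hg' hgordo
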